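/- **Setting.** Let $\mathcal M=(\mathcal S,\mathcal A,r,P,\rho)$ be a Markov decision process with finite nonempty state space $\mathcal S$, finite action space $\mathcal A$ of size $A\ge 1$, rewards $r:\mathcal S\times\mathcal A\to[0,1]$, transition probabilities $P(s'|s,a)$ and initial state distribution $\rho$. A policy $\pi$ assigns to each state $s$ a probability distribution $\pi(\cdot|s)$ on $\mathcal A$; put $P^\pi(s,s')=\sum_a P(s'|s,a)\pi(a|s)$. Assume that $\mathcal M$ is ergodic: for every policy $\pi$ the chain $P^\pi$ is irreducible and aperiodic. Let $d^\pi$ be its stationary distribution, $J^\pi=\sum_{s,a}r(s,a)d^\pi(s)\pi(a|s)$ the long-term average reward, $V^\pi(s)=\sum_{t\ge 0}\big(\mathbb E_\pi[r(s_t,a_t)|s_0=s]-J^\pi\big)$, $Q^\pi(s,a)=\sum_{t\ge 0}\big(\mathbb E_\pi[r(s_t,a_t)|s_0=s,a_0=a]-J^\pi\big)$ and $A^\pi=Q^\pi-V^\pi$. Let $\pi^*$ be a policy maximizing $J^\pi$ over all policies, and $J^*=J^{\pi^*}$. Let $(\pi_\theta)_{\theta\in\mathbb R^d}$, $d\ge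 1$, be a family of policies with $\pi_\theta(a|s)>0$, and $J(\theta)=J^{\pi_\theta}$. Let $t_{\mathrm{mix}}=\sup_\theta\min\{t\ge 1:\|(P^{\pi_\theta})^t(s,\cdot)-d^{\pi_\theta}\|_1\le \frac14\ \forall s\}$ and $t_{\mathrm{hit}}=\sup_\theta\max_s 1/d^{\pi_\theta}(s)$ (both are finite). Assume that, for constants $G,B,L_h,\epsilon_{\mathrm{bias}}\ge 0$ and $\mu>0$: 1. for all $s,a$ the function $\theta\mapsto\log\pi_\theta(a|s)$ is twice differentiable with $\|\nabla_\theta\log\pi_\theta(a|s)\|\le G$ and $\|\nabla^2_\theta\log\pi_\theta(a|s)\|\le B$ for all $\theta$; 2. for all $\theta$, $F(\theta)-\mu I_d$ is positive semidefinite, where $F(\theta)=\mathbb E_{s\sim d^{\pi_\theta},a\sim\pi_\theta(\cdot|s)}[\nabla_\theta\log\pi_\theta(a|s)\nabla_\theta\log\pi_\theta(a|s)^\top]$; 3. for all $\theta$, $\mathbb E_{s\sim d^{\pi^*},a\sim\pi^*(\cdot|s)}\big[(\nabla_\theta\log\pi_\theta(a|s)\cdot\omega^*_\theta-A^{\pi_\theta}(s,a))^2\big]\le\epsilon_{\mathrm{bias}}$,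 where $\omega^*_\theta$ minimizes $\omega\mapsto\mathbb E_{s\sim d^{\pi_\theta},a\sim\pi_\theta(\cdot|s)}\big[(\nabla_\theta\log\pi_\theta(a|s)\cdot\omega-A^{\pi_\theta}(s,a))^2\big]$ over $\mathbb R^d$; 4. $\nabla J$ is $L_h$-smooth, i.e. $\nabla J$ is differentiable and $\nabla^2J$ is $L_h$-Lipschitz. **Algorithm.** Let $T\ge 2$ be the horizon and $$\gamma_k=\tfrac{6G}{\mu(k+2)},\quad \eta_k=\big(\tfrac{2}{k+2}\big)^{4/5},\quad H=\big\lceil 63\,t_{\mathrm{mix}}t_{\mathrm{hit}}(\log_2T)^2T^{1/6}\big\rceil,\quad N=\lceil 7t_{\mathrm{mix}}\log_2T\rceil .$$ Let $\theta_0,\theta_1\in\mathbb R^d$ be arbitrary, $d_0=0$, $s_0\sim\rho$. In epoch $k=1,2,\dots$, consisting of the times $(k-1)H\le t\le kH-1$, put $\tilde\theta_k=\theta_k+\frac{1-\eta_k}{\eta_k}(\theta_k-\theta_{k-1})$, draw $a_t\sim\pi_{\tilde\theta_k}(\cdot|s_t)$ and $s_{t+1}\sim P(\cdot|s_t,a_t)$,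 and let $\tilde\tau_k$ be the resulting trajectory; then set $$d_k=(1-\eta_k)d_{k-1}+\eta_k\,g(\tilde\theta_k,\tilde\tau_k),\qquad \theta_{k+1}=\theta_k+\gamma_k\frac{d_k}{\|d_k\|}$$ ($\theta_{k+1}=\theta_k$ if $d_k=0$). Here, for a trajectory $\tau=\{(s_t,a_t)\}_{t=t_s}^{t_e}$ of length $H$, $$g(\theta,\tau)=\frac1{H-N}\sum_{t=t_s+N}^{t_e}\big(\hat Q(s_t,a_t)-\hat V(s_t)\big)\nabla_\theta\log\pi_\theta(a_t|s_t),$$ $$\hat V(s)=\frac1i\sum_{j=1}^iy_j,\qquad \hat Q(s,a)=\frac1{i\,\pi_\theta(a|s)}\sum_{j=1}^iy_j\mathbf 1(a_{\xi_j}=a)$$ (both $0$ if $i=0$), where $\xi_1<\dots<\xi_i$ are found by scanning from $\xi=t_s$ while $\xi\le t_e-N$: if $s_\xi=s$, record $\xi$ and continue from $\xi+2N$, otherwise continue from $\xi+1$; and $y_j=\sum_{t=\xi_j}^{\xi_j+N-1}r(s_t,a_t)$. The algorithm is stopped after $T$ steps, i.e. after $\lfloor T/H\rfloor$ full epochs and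 possibly a part of the next one. Let $\mathrm{Reg}_T=\sum_{t=0}^{T-1}(J^*-r(s_t,a_t))$. **Theorem.** There is an absolute constant $C>0$ such that in every such situation, for all $T\ge 2$, $$\mathbb E[\mathrm{Reg}_T]\le T\sqrt{\epsilon_{\mathrm{bias}}}+C\Big(G^2A\,t_{\mathrm{mix}}^{7/5}t_{\mathrm{hit}}^{2/5}(\log T)^{9/5}+G^3\mu^{-2}t_{\mathrm{mix}}^{2/5}t_{\mathrm{hit}}^{2/5}L_h(\log T)^{4/5}+\sqrt A\,BG\,t_{\mathrm{mix}}^{7/5}t_{\mathrm{hit}}^{2/5}(\log T)^{9/5}+\sqrt A\,G^2t_{\mathrm{mix}}^{12/5}t_{\mathrm{hit}}^{7/5}(\log T)^{14/5}\Big)\mu^{-1}T^{2/3}.$$ -/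

import Mathlib

noncomputable section

namespace AvgMDP

open scoped Matrix Gradient

universe u v

/-- The parameter space `ℝ^d` with the Euclidean norm. -/
abbrev Param (d : ℕ) := EuclideanSpace ℝ (Fin d)

/-- A finite Markov decision process: rewards in `[0,1]`, transition probabilities
`P s a s' = P(s' | s, a)`, and the initial state distribution `ρ`. -/
structure MDP (S : Type u) (A : Type v) [Fintype S] where
  r : S → A → ℝ
  P : S → A → S → ℝ
  ρ : S → ℝ
  r_mem : ∀ s a, r s a ∈ Set.Icc (0 : ℝ) 1
  P_mem : ∀ s a, P s a ∈ stdSimplex ℝ S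
  ρ_mem : ρ ∈ stdSimplex ℝ S

/-- `π s a = π(a | s)` is a (stationary, randomized) policy. -/
def IsPolicy {S : Type u} {A : Type v} [Fintype A] (π : S → A → ℝ) : Prop :=
  ∀ s, π s ∈ stdSimplex ℝ A

/-- Every state has period one. -/
def Aperiodic {S : Type u} [Fintype S] [DecidableEq S] (M : Matrix S S ℝ) : Prop :=
  ∀ s, ∀ k : ℕ, (∀ n : ℕ, 1 ≤ n → 0 < (M ^ n) s s → k ∣ n) → k = 1

variable {S : Type u} {A : Type v} [Fintype S] [Fintype A] [DecidableEq S] [DecidableEq A]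

namespace MDP

variable (M : MDP S A)

/-- The state transition matrix `P^π`. -/
def trans (π : S → A → ℝ) : Matrix S S ℝ :=
  Matrix.of fun s s' => ∑ a, M.P s a s' * π s a

/-- The Markov chain induced by every policy is irreducible and aperiodic. -/
def Ergodic : Prop :=
  ∀ π : S → A → ℝ, IsPolicy π → (M.trans π).IsIrreducible ∧ Aperiodic (M.trans π)

/-- `q` is a stationary distribution of the chain induced by `π`. -/
def IsStationary (π : S → A → ℝ) (q : S → ℝ) : Prop :=
  q ∈ stdSimplex ℝ S ∧ q ᵥ* M.trans π = q

/-- The stationary distribution `d^π` (it exists and is unique in an ergodic MDP). -/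
def statDist (π : S → A → ℝ) : S → ℝ :=
  Classical.epsilon (M.IsStationary π)

/-- The long-term average reward `J^π`. -/
def avgReward (π : S → A → ℝ) : ℝ :=
  ∑ s, ∑ a, M.r s a * M.statDist π s * π s a

/-- `r^π(s)`. -/
def polReward (π : S → A → ℝ) (s : S) : ℝ := ∑ a, M.r s a * π s a

/-- The state value function: `∑_{t ≥ 0} (E[r(s_t,a_t) | s_0 = s] - J^π)`. -/
def V (π : S → A → ℝ) (s : S) : ℝ :=
  ∑' t : ℕ, ((M.trans π ^ t *ᵥ M.polReward π) s - M.avgReward π)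

/-- `E[r(s_t,a_t) | s_0 = s, a_0 = a]` when the policy `π` is followed from time `1` on. -/
def expReward (π : S → A → ℝ) (s : S) (a : A) : ℕ → ℝ
  | 0 => M.r s a
  | t + 1 => ∑ s', M.P s a s' * (M.trans π ^ t *ᵥ M.polReward π) s'

/-- The state-action value function:
`∑_{t ≥ 0} (E[r(s_t,a_t) | s_0 = s, a_0 = a] - J^π)`. -/
def Q (π : S → A → ℝ) (s : S) (a : A) : ℝ :=
  ∑' t : ℕ, (M.expReward π s a t - M.avgReward π)

/-- The advantage function. -/
def Adv (π : S → A → ℝ) (s : S) (a : A) : ℝ := M.Q π s a - M.V π s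

/-- `π` maximizes the long-term average reward among all policies. -/
def IsOptimal (π : S → A → ℝ) : Prop :=
  IsPolicy π ∧ ∀ π' : S → A → ℝ, IsPolicy π' → M.avgReward π' ≤ M.avgReward π

/-- The mixing time of one policy, with respect to the `ℓ¹` distance. -/
def mixTimeOf (π : S → A → ℝ) : ℕ :=
  sInf {t : ℕ | 1 ≤ t ∧
    ∀ s, ∑ s', |(M.trans π ^ t) s s' - M.statDist π s'| ≤ 1 / 4}

/-- The hitting time of one policy. -/
def hitTimeOf (π : S → A → ℝ) : ℝ := ⨆ s, 1 / M.statDist π s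

section Parametrized

variable {d : ℕ} (pol : Param d → S → A → ℝ)

/-- The overall mixing time `t_mix` of a parametrized policy class. -/
def mixTime : ℕ := ⨆ θ, M.mixTimeOf (pol θ)

/-- The overall hitting time `t_hit` of a parametrized policy class. -/
def hitTime : ℝ := ⨆ θ, M.hitTimeOf (pol θ)

/-- `J(θ)`. -/
def J (θ : Param d) : ℝ := M.avgReward (pol θ)

end Parametrized

end MDP

section Parametrized

variable {d : ℕ} (pol : Param d → S → A → ℝ)

/-- The score function `∇_θ log π_θ(a | s)`. -/
def score (θ : Param d) (s : S) (a : A) : Param d :=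
  ∇ (fun ϑ => Real.log (pol ϑ s a)) θ

/-- The policies `π_θ` have full support, `log π_θ(a | s)` is twice differentiable in `θ`, with
gradient bounded by `G` and Hessian bounded by `B` in operator norm. -/
structure Regular (G B : ℝ) : Prop where
  isPolicy : ∀ θ, IsPolicy (pol θ)
  pos : ∀ θ s a, 0 < pol θ s a
  diff : ∀ s a, Differentiable ℝ fun θ => Real.log (pol θ s a)
  diff_score : ∀ s a, Differentiable ℝ fun θ => score pol θ s a
  norm_score_le : ∀ θ s a, ‖score pol θ s a‖ ≤ G
  norm_hessian_le : ∀ θ s a, ‖fderiv ℝ (fun ϑ => score pol ϑ s a) θ‖ ≤ B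

/-- The compatible function approximation error at `θ` of the direction `ω`, with states drawn
from `q` and actions from `π`. -/
def approxError (M : MDP S A) (q : S → ℝ) (π : S → A → ℝ) (ω θ : Param d) : ℝ :=
  ∑ s, ∑ a, q s * π s a * (inner ℝ (score pol θ s a) ω - M.Adv (pol θ) s a) ^ 2

/-- `ω` is the natural policy gradient direction at `θ`: it minimizes the approximation error
under `s ∼ d^{π_θ}`, `a ∼ π_θ(· | s)`. -/
def IsNPGDirection (M : MDP S A) (θ ω : Param d) : Prop :=
  ∀ ω', approxError pol M (M.statDist (pol θ)) (pol θ) ω θ ≤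
    approxError pol M (M.statDist (pol θ)) (pol θ) ω' θ

/-- The transferred function approximation error is at most `ε` at every parameter. -/
def TransferErrorLE (M : MDP S A) (πstar : S → A → ℝ) (ε : ℝ) : Prop :=
  ∀ θ ω, IsNPGDirection pol M θ ω →
    approxError pol M (M.statDist πstar) πstar ω θ ≤ ε

/-- The Fisher information matrix `F(θ)`. -/
def fisher (M : MDP S A) (θ : Param d) : Matrix (Fin d) (Fin d) ℝ :=
  ∑ s, ∑ a, (M.statDist (pol θ) s * pol θ s a) •
    Matrix.vecMulVec (score pol θ s a).ofLp (score pol θ s a).ofLp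

/-- The policies are Fisher non-degenerate: `F(θ) - μ I` is positive semidefinite. -/
def FisherNondegenerate (M : MDP S A) (μ : ℝ) : Prop :=
  ∀ θ, (fisher pol M θ - μ • (1 : Matrix (Fin d) (Fin d) ℝ)).PosSemidef

/-- `∇f` is `L`-smooth: it is differentiable with `L`-Lipschitz derivative. -/
def GradientSmooth (f : Param d → ℝ) (L : NNReal) : Prop :=
  Differentiable ℝ (∇ f) ∧ LipschitzWith L (fderiv ℝ (∇ f))

/-! ### Value estimation from one trajectory

A trajectory of length `H` is given by the values `τ 0, …, τ (H - 1)` of `τ : ℕ → S × A`. -/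

/-- The successive start times of the sub-trajectories used to estimate the values at `s`: from
time `ξ` on, while `ξ ≤ (H - 1) - N`, record `ξ` and jump to `ξ + 2N` if the state at time `ξ` is
`s`, and move to `ξ + 1` otherwise. The first argument bounds the number of loop iterations. -/
def startTimes (N H : ℕ) (τ : ℕ → S × A) (s : S) : ℕ → ℕ → List ℕ
  | 0, _ => []
  | fuel + 1, ξ =>
    if ξ + N < H then
      if (τ ξ).1 = s then ξ :: startTimes N H τ s fuel (ξ + 2 * N)
      else startTimes N H τ s fuel (ξ + 1)
    else []

/-- All start times `ξ_1 < ξ_2 < … < ξ_i` for the state `s`; `H` iterations exhaust the loop. -/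
def starts (N H : ℕ) (τ : ℕ → S × A) (s : S) : List ℕ := startTimes N H τ s H 0

/-- The sum of the `N` rewards collected from time `ξ` on. -/
def rewardSum (M : MDP S A) (N : ℕ) (τ : ℕ → S × A) (ξ : ℕ) : ℝ :=
  ∑ j ∈ Finset.range N, M.r (τ (ξ + j)).1 (τ (ξ + j)).2

/-- The estimate of `V^π(s)`; it is zero if there is no start time. -/
def Vhat (M : MDP S A) (N H : ℕ) (τ : ℕ → S × A) (s : S) : ℝ :=
  ((starts N H τ s).map (rewardSum M N τ)).sum / (starts N H τ s).length

/-- The estimate of `Q^π(s, a)`; it is zero if there is no start time. -/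
def Qhat (M : MDP S A) (N H : ℕ) (π : S → A → ℝ) (τ : ℕ → S × A) (s : S) (a : A) : ℝ :=
  ((starts N H τ s).map fun ξ => if (τ ξ).2 = a then rewardSum M N τ ξ else 0).sum /
    ((starts N H τ s).length * π s a)

/-- The advantage estimate. -/
def Ahat (M : MDP S A) (N H : ℕ) (π : S → A → ℝ) (τ : ℕ → S × A) (s : S) (a : A) : ℝ :=
  Qhat M N H π τ s a - Vhat M N H τ s

/-- The policy gradient estimate `g(θ, τ)`. -/
def gradEst (M : MDP S A) (N H : ℕ) (θ : Param d) (τ : ℕ → S × A) : Param d :=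
  ((H : ℝ) - N)⁻¹ • ∑ t ∈ Finset.Ico N H,
    Ahat M N H (pol θ) τ (τ t).1 (τ t).2 • score pol θ (τ t).1 (τ t).2

/-! ### Policy gradient with implicit gradient transport -/

/-- The inputs of the algorithm: initial parameters, step sizes, momentum parameters, epoch
length, and buffer length. -/
structure Input (d : ℕ) where
  θ₀ : Param d
  θ₁ : Param d
  γ : ℕ → ℝ
  η : ℕ → ℝ
  H : ℕ
  N : ℕ

/-- `θ_k + ((1 - η_k) / η_k) (θ_k - θ_{k-1})`. -/
def lookahead (η : ℝ) (θprev θ : Param d) : Param d := θ + ((1 - η) / η) • (θ - θprev)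

/-- The triple `(θ_k, θ_{k+1}, d_k)` computed by the algorithm from the observed state-action
sequence `x`, with `d_0 = 0`. Epoch `k + 1` uses the trajectory `x (kH), …, x ((k+1)H - 1)`.
The parameter stays put if the direction vanishes. -/
def iterates (M : MDP S A) (I : Input d) (x : ℕ → S × A) :
    ℕ → Param d × Param d × Param d
  | 0 => (I.θ₀, I.θ₁, 0)
  | k + 1 =>
    let p := iterates M I x k
    let θt := lookahead (I.η (k + 1)) p.1 p.2.1
    let g := gradEst pol M I.N I.H θt fun j => x (k * I.H + j)
    let dir := (1 - I.η (k + 1)) • p.2.2 + I.η (k + 1) • g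
    (p.2.1, p.2.1 + I.γ (k + 1) • (‖dir‖⁻¹ • dir), dir)

/-- The parameter `θ̃_{k+1}` whose policy is executed during epoch `k + 1`. -/
def execParam (M : MDP S A) (I : Input d) (x : ℕ → S × A) (k : ℕ) : Param d :=
  lookahead (I.η (k + 1)) (iterates pol M I x k).1 (iterates pol M I x k).2.1

/-- The probability that the first `T ≥ 1` state-action pairs are `x 0, …, x (T - 1)` when the
algorithm is run: `s_0 ∼ ρ`, the action at time `t` is drawn from the policy of the epoch
`t / H + 1` that contains `t`, and `s_{t+1} ∼ P(· | s_t, a_t)`. -/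
def trajProb (M : MDP S A) (I : Input d) (T : ℕ) (x : ℕ → S × A) : ℝ :=
  M.ρ (x 0).1 *
    (∏ t ∈ Finset.range T, pol (execParam pol M I x (t / I.H)) (x t).1 (x t).2) *
    ∏ t ∈ Finset.range (T - 1), M.P (x t).1 (x t).2 (x (t + 1)).1

/-- Extension of a finite state-action sequence by arbitrary values. -/
def extend [Nonempty S] [Nonempty A] {T : ℕ} (x : Fin T → S × A) (t : ℕ) : S × A :=
  if h : t < T then x ⟨t, h⟩ else Classical.arbitrary (S × A)

/-- The regret `∑_{t < T} (J^* - r(s_t, a_t))`. -/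
def regret (M : MDP S A) (Jstar : ℝ) (T : ℕ) (x : ℕ → S × A) : ℝ :=
  ∑ t ∈ Finset.range T, (Jstar - M.r (x t).1 (x t).2)

/-- The expected regret of the algorithm over the first `T` steps. -/
def expRegret [Nonempty S] [Nonempty A] (M : MDP S A) (I : Input d) (Jstar : ℝ) (T : ℕ) : ℝ :=
  ∑ x : Fin T → S × A,
    trajProb pol M I T (extend x) * regret M Jstar T (extend x)

/-- The inputs prescribed for the horizon `T`, with integer lengths obtained by rounding up:
`γ_k = 6G / (μ(k+2))`, `η_k = (2/(k+2))^{4/5}`, `H = ⌈63 t_mix t_hit (log₂ T)² T^{1/6}⌉`,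
`N = ⌈7 t_mix log₂ T⌉`. -/
def prescribedInput (M : MDP S A) (G μ : ℝ) (T : ℕ) (θ₀ θ₁ : Param d) : Input d where
  θ₀ := θ₀
  θ₁ := θ₁
  γ := fun k => 6 * G / (μ * ((k : ℝ) + 2))
  η := fun k => (2 / ((k : ℝ) + 2)) ^ ((4 : ℝ) / 5)
  H := ⌈63 * (M.mixTime pol : ℝ) * M.hitTime pol * Real.logb 2 T ^ 2 *
    (T : ℝ) ^ ((1 : ℝ) / 6)⌉₊
  N := ⌈7 * (M.mixTime pol : ℝ) * Real.logb 2 T⌉₊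

end Parametrized

/-- The rate of the regret bound, for `nA` actions, mixing time `tm` and hitting time `th`. -/
def regretRate (nA G B Lh tm th μ T : ℝ) : ℝ :=
  (G ^ 2 * nA * tm ^ ((7 : ℝ) / 5) * th ^ ((2 : ℝ) / 5) * Real.log T ^ ((9 : ℝ) / 5)
    + G ^ 3 * (μ ^ 2)⁻¹ * tm ^ ((2 : ℝ) / 5) * th ^ ((2 : ℝ) / 5) * Lh *
        Real.log T ^ ((4 : ℝ) / 5)
    + √nA * B * G * tm ^ ((7 : ℝ) / 5) * th ^ ((2 : ℝ) / 5) * Real.log T ^ ((9 : ℝ) / 5)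
    + √nA * G ^ 2 * tm ^ ((12 : ℝ) / 5) * th ^ ((7 : ℝ) / 5) * Real.log T ^ ((14 : ℝ) / 5))
  * μ⁻¹ * T ^ ((2 : ℝ) / 3)

end AvgMDP

end

/-! The transfer error hypothesis holds at every parameter, and this already forces every policy of
the class to be nearly optimal. Given `θ₀`, minimize `J + δ‖· - θ₀‖²`: the minimizer has performance
at most `J(θ₀)` and a policy gradient of size `O(√δ)` (`Regular.exists_near_critical`). Fisher
non-degeneracy makes the natural gradient direction `ω` equally small there
(`exists_isNPGDirection`). The performance difference lemma together with Jensen's inequality bounds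
the suboptimality by `√ε + G‖ω‖` (`TransferErrorLE.sub_le`). Letting `δ → 0` gives `J* - J(θ) ≤ √ε`
for all `θ` (`TransferErrorLE.sub_le_sqrt`), so the accuracy of the gradient estimates plays no
role.

What remains is the gap between the collected rewards and the average rewards of the executed
policies. By the Bellman equation this gap telescopes in expectation inside each epoch, and an epoch
change costs the change of the value function (`trajExp_execRegret_sub_le`). The value function is
Lipschitz in the policy with constant of order `t_mix²` (`MDP.abs_V_sub_le`). Because updates are
normalized, consecutive executed parameters differ by `O(γ_k / η_{k+1}) = O((G/μ) k^(-1/5))`,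
whatever the directions are (`norm_execParam_sub_le`). Summing over at most `T^(5/6)` epochs gives
`t_mix² (G²/μ) T^(2/3)`, which the last term of the rate dominates (`le_regretRate`).

Uniform mixing over all policies comes from compactness of the set of policies
(`MDP.Ergodic.exists_minorization`). It makes the mixing and hitting times genuine suprema. -/

noncomputable section

namespace AvgMDP

open scoped Matrix Topology
open Matrix Filter

universe u v

set_option linter.unusedSectionVars false

section Chain

variable {S : Type u} [Fintype S] [DecidableEq S]

/-! ### Finite Markov chains -/

/-- The `ℓ¹` distance between the `t`-step distribution from `s` and `q`. -/
def mixDist (P : Matrix S S ℝ) (q : S → ℝ) (t : ℕ) (s : S) : ℝ := ∑ s', |(P ^ t) s s' - q s'|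

lemma sum_row_pow {P : Matrix S S ℝ} (hP : P ∈ rowStochastic ℝ S) (t : ℕ) (s : S) :
    ∑ s', (P ^ t) s s' = 1 :=
  sum_row_of_mem_rowStochastic (pow_mem hP t) s

lemma pow_entry_nonneg {P : Matrix S S ℝ} (hP : P ∈ rowStochastic ℝ S) (t : ℕ) (s s' : S) :
    0 ≤ (P ^ t) s s' :=
  nonneg_of_mem_rowStochastic (pow_mem hP t)

/-- Averaging against a probability vector preserves lower bounds of columns. -/
lemma le_pow_entry {P : Matrix S S ℝ} (hP : P ∈ rowStochastic ℝ S) {δ : ℝ} {n : ℕ}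
    (h : ∀ i j, δ ≤ (P ^ n) i j) {m : ℕ} (hm : n ≤ m) (i j : S) : δ ≤ (P ^ m) i j := by
  obtain ⟨k, rfl⟩ := Nat.exists_eq_add_of_le' hm
  rw [pow_add, Matrix.mul_apply]
  calc δ = ∑ l, (P ^ k) i l * δ := by rw [← Finset.sum_mul, sum_row_pow hP, one_mul]
    _ ≤ _ := Finset.sum_le_sum fun l _ =>
      mul_le_mul_of_nonneg_left (h l j) (pow_entry_nonneg hP k i l)

/-- Return times are closed under addition and have gcd one by aperiodicity, so the additive monoid
they generate contains every large integer. -/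
lemma exists_return_time {P : Matrix S S ℝ} (hP : P ∈ rowStochastic ℝ S) (hA : Aperiodic P)
    (s : S) : ∃ n, ∀ m ≥ n, 0 < (P ^ m) s s := by
  set R : Set ℕ := {n | 1 ≤ n ∧ 0 < (P ^ n) s s} with hR
  have h1 : Nat.setGcd R = 1 :=
    hA s _ fun n hn hpos => Nat.setGcd_dvd_of_mem ⟨hn, hpos⟩
  obtain ⟨n, hn⟩ := Nat.exists_mem_closure_of_ge R
  refine ⟨n, fun m hm => ?_⟩
  have hmem := hn m hm (h1 ▸ one_dvd m)
  refine AddSubmonoid.closure_induction (motive := fun k _ => 0 < (P ^ k) s s)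
    (fun k hk => hk.2) (by simp) (fun a b _ _ ha hb => ?_) hmem
  rw [pow_add, Matrix.mul_apply]
  exact (mul_pos ha hb).trans_le (Finset.single_le_sum (f := fun l => (P ^ a) s l * (P ^ b) l s)
    (fun l _ => mul_nonneg (pow_entry_nonneg hP a s l) (pow_entry_nonneg hP b l s))
    (Finset.mem_univ s))

/-- To go from `i` to `j` in exactly `K` steps, first return to `i` after `K - k i j` steps, then
follow a path of length `k i j`. The total `K` is large enough that the first stage is always
possible. -/
lemma exists_pow_pos {P : Matrix S S ℝ} (hP : P ∈ rowStochastic ℝ S) (hI : P.IsIrreducible)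
    (hA : Aperiodic P) : ∃ n, ∀ i j, 0 < (P ^ n) i j := by
  choose k _ hk using (isIrreducible_iff_exists_pow_pos hI.nonneg).1 hI
  choose n hn using exists_return_time hP hA
  let K := ∑ i, ∑ j, k i j + ∑ i, n i
  refine ⟨K, fun i j => ?_⟩
  have hki : k i j ≤ ∑ i, ∑ j, k i j :=
    (Finset.single_le_sum (f := fun j => k i j) (fun _ _ => Nat.zero_le _)
      (Finset.mem_univ j)).trans
      (Finset.single_le_sum (f := fun i => ∑ j, k i j) (fun _ _ => Nat.zero_le _)
        (Finset.mem_univ i))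
  have hni : n i ≤ ∑ i, n i := Finset.single_le_sum (fun _ _ => Nat.zero_le _) (Finset.mem_univ i)
  have hK : K = (K - k i j) + k i j := by omega
  rw [hK, pow_add, Matrix.mul_apply]
  exact (mul_pos (hn i (K - k i j) (by omega)) (hk i j)).trans_le
    (Finset.single_le_sum (f := fun l => (P ^ (K - k i j)) i l * (P ^ k i j) l j)
    (fun l _ => mul_nonneg (pow_entry_nonneg hP _ i l) (pow_entry_nonneg hP _ l j))
    (Finset.mem_univ i))

/-- Every stochastic matrix has a stationary distribution. -/
lemma exists_stationary [Nonempty S] {P : Matrix S S ℝ} (hP : P ∈ rowStochastic ℝ S) :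
    ∃ q ∈ stdSimplex ℝ S, q ᵥ* P = q := by
  have hdet : (P - 1).det = 0 := by
    refine Matrix.exists_mulVec_eq_zero_iff.1 ⟨1, one_ne_zero, ?_⟩
    rw [Matrix.sub_mulVec, hP.2, Matrix.one_mulVec, sub_self]
  obtain ⟨x, hx0, hx⟩ := Matrix.exists_vecMul_eq_zero_iff.2 hdet
  rw [Matrix.vecMul_sub, Matrix.vecMul_one, sub_eq_zero] at hx
  have hle : ∀ j, |x j| ≤ ((fun i => |x i|) ᵥ* P) j := fun j => by
    conv_lhs => rw [← hx]
    simp only [Matrix.vecMul, dotProduct]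
    refine (Finset.abs_sum_le_sum_abs _ _).trans_eq (Finset.sum_congr rfl fun i _ => ?_)
    rw [abs_mul, abs_of_nonneg (hP.1 i j)]
  have hsum : ∑ j, |x j| = ∑ j, ((fun i => |x i|) ᵥ* P) j := by
    simp only [Matrix.vecMul, dotProduct]
    rw [Finset.sum_comm]
    refine Finset.sum_congr rfl fun i _ => ?_
    rw [← Finset.mul_sum, sum_row_of_mem_rowStochastic hP, mul_one]
  -- The left null vector `x` may change sign. The triangle inequality gives `|x| ≤ |x| P`
  -- entrywise, and both sides have the same total mass, so equality holds in every entry.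
  have heq : (fun i => |x i|) ᵥ* P = fun i => |x i| := funext fun j =>
    ((Finset.sum_eq_sum_iff_of_le fun j _ => hle j).1 hsum j (Finset.mem_univ j)).symm
  have hpos : 0 < ∑ j, |x j| := by
    obtain ⟨j, hj⟩ := Function.ne_iff.1 hx0
    exact Finset.sum_pos' (fun i _ => abs_nonneg _) ⟨j, Finset.mem_univ _, abs_pos.2 hj⟩
  refine ⟨(∑ j, |x j|)⁻¹ • fun i => |x i|, ⟨fun i => ?_, ?_⟩, ?_⟩
  · exact mul_nonneg (inv_nonneg.2 hpos.le) (abs_nonneg _)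
  · simp only [Pi.smul_apply, smul_eq_mul, ← Finset.mul_sum]
    exact inv_mul_cancel₀ hpos.ne'
  · rw [Matrix.smul_vecMul, heq]

/-! ### Convergence to stationarity and the Poisson equation. -/

section Stationary

variable {P : Matrix S S ℝ} {q : S → ℝ}

lemma stationary_pow (hq : q ᵥ* P = q) (t : ℕ) : q ᵥ* P ^ t = q := by
  induction t with
  | zero => simp
  | succ t ih => rw [pow_succ, ← Matrix.vecMul_vecMul, ih, hq]

lemma stationary_pow_apply (hq : q ᵥ* P = q) (t : ℕ) (j : S) : ∑ i, q i * (P ^ t) i j = q j :=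
  congrFun (stationary_pow hq t) j

lemma le_stationary (hqs : q ∈ stdSimplex ℝ S) (hq : q ᵥ* P = q) {δ : ℝ} {n : ℕ}
    (h : ∀ i j, δ ≤ (P ^ n) i j) (j : S) : δ ≤ q j := by
  rw [← stationary_pow_apply hq n j]
  calc δ = ∑ i, q i * δ := by rw [← Finset.sum_mul, hqs.2, one_mul]
    _ ≤ _ := Finset.sum_le_sum fun i _ => mul_le_mul_of_nonneg_left (h i j) (hqs.1 i)

lemma mixDist_nonneg (t : ℕ) (s : S) : 0 ≤ mixDist P q t s :=
  Finset.sum_nonneg fun _ _ => abs_nonneg _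

lemma mixDist_le_two (hP : P ∈ rowStochastic ℝ S) (hqs : q ∈ stdSimplex ℝ S) (t : ℕ) (s : S) :
    mixDist P q t s ≤ 2 := by
  calc mixDist P q t s ≤ ∑ s', ((P ^ t) s s' + q s') := Finset.sum_le_sum fun s' _ =>
        abs_sub_le_of_nonneg_of_le (pow_entry_nonneg hP t s s')
          (le_add_of_nonneg_right (hqs.1 s')) (hqs.1 s')
          (le_add_of_nonneg_left (pow_entry_nonneg hP t s s'))
    _ = 2 := by rw [Finset.sum_add_distrib, sum_row_pow hP, hqs.2]; norm_num

/-- The deviation from stationarity after `t + m` steps, from the deviation after `t` steps. -/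
lemma pow_add_sub_stationary (hP : P ∈ rowStochastic ℝ S) (hqs : q ∈ stdSimplex ℝ S)
    (hq : q ᵥ* P = q) (t m : ℕ) (c : ℝ) (s j : S) :
    (P ^ (t + m)) s j - q j = ∑ i, ((P ^ t) s i - q i) * ((P ^ m) i j - c) := by
  -- A difference of two probability vectors annihilates constants, so `c` is free and may be chosen
  -- separately for each column `j`.
  have h : ∑ i, ((P ^ t) s i - q i) * c = 0 := by
    rw [← Finset.sum_mul, Finset.sum_sub_distrib, sum_row_pow hP, hqs.2, sub_self, zero_mul]
  simp only [mul_sub (_ - _ : ℝ), Finset.sum_sub_distrib, h, sub_zero]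
  simp only [sub_mul, Finset.sum_sub_distrib, stationary_pow_apply hq, pow_add, Matrix.mul_apply]

/-- The reference vector `c` serves two purposes: a constant `δ` gives the contraction from a
minorization, and `c = q` gives submultiplicativity at the mixing time. -/
lemma mixDist_add_le (hP : P ∈ rowStochastic ℝ S) (hqs : q ∈ stdSimplex ℝ S)
    (hq : q ᵥ* P = q) {m : ℕ} {c : S → ℝ} {κ : ℝ}
    (h : ∀ i, ∑ j, |(P ^ m) i j - c j| ≤ κ) (t : ℕ) (s : S) :
    mixDist P q (t + m) s ≤ κ * mixDist P q t s := by
  unfold mixDist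
  calc ∑ j, |(P ^ (t + m)) s j - q j|
      ≤ ∑ j, ∑ i, |(P ^ t) s i - q i| * |(P ^ m) i j - c j| := Finset.sum_le_sum fun j _ => by
        rw [pow_add_sub_stationary hP hqs hq t m (c j)]
        refine (Finset.abs_sum_le_sum_abs _ _).trans_eq (Finset.sum_congr rfl fun i _ => abs_mul _ _)
    _ = ∑ i, |(P ^ t) s i - q i| * ∑ j, |(P ^ m) i j - c j| := by
        rw [Finset.sum_comm]; simp only [Finset.mul_sum]
    _ ≤ ∑ i, |(P ^ t) s i - q i| * κ := Finset.sum_le_sum fun i _ =>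
        mul_le_mul_of_nonneg_left (h i) (abs_nonneg _)
    _ = _ := by rw [← Finset.sum_mul, mul_comm]

/-- Geometric convergence of a chain that satisfies a minorization condition. -/
lemma mixDist_mul_le [Nonempty S] (hP : P ∈ rowStochastic ℝ S) (hqs : q ∈ stdSimplex ℝ S)
    (hq : q ᵥ* P = q) {δ : ℝ} {n : ℕ} (h : ∀ i j, δ ≤ (P ^ n) i j) (k : ℕ) (s : S) :
    mixDist P q (n * k) s ≤ (1 - Fintype.card S * δ) ^ k * 2 := by
  -- After subtracting the common lower bound `δ` the row is still nonnegative, so its `ℓ¹` norm is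
  -- its mass.
  have hrow : ∀ i, ∑ j, |(P ^ n) i j - δ| ≤ 1 - Fintype.card S * δ := fun i => by
    simp only [abs_of_nonneg (sub_nonneg.2 (h i _)), Finset.sum_sub_distrib, sum_row_pow hP]
    simp
  have h0 : 0 ≤ 1 - Fintype.card S * δ :=
    (Finset.sum_nonneg fun _ _ => abs_nonneg _).trans (hrow (Classical.arbitrary S))
  induction k with
  | zero => simpa using mixDist_le_two hP hqs 0 s
  | succ k ih =>
    rw [Nat.mul_succ, pow_succ', mul_assoc]
    exact (mixDist_add_le hP hqs hq (c := fun _ => δ) hrow (n * k) s).trans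
      (mul_le_mul_of_nonneg_left ih h0)

/-- The deviations from stationarity are summable, with sum of the order of the mixing time. -/
lemma sum_mixDist_le (hP : P ∈ rowStochastic ℝ S) (hqs : q ∈ stdSimplex ℝ S)
    (hq : q ᵥ* P = q) {m : ℕ} (h : ∀ i, mixDist P q m i ≤ 1 / 4) (n : ℕ) (s : S) :
    ∑ t ∈ Finset.range n, mixDist P q t s ≤ 3 * m := by
  -- The first `m` terms are at most `2`, and a shift by `m` gains a factor `1/4`. The sum `X`
  -- therefore satisfies `X ≤ 2m + X/4`, whence `X ≤ 8m/3`.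
  have h1 : ∑ t ∈ Finset.range (m + n), mixDist P q t s ≤
      2 * m + 1 / 4 * ∑ t ∈ Finset.range n, mixDist P q t s := by
    rw [Finset.sum_range_add]
    refine add_le_add ?_ ?_
    · refine (Finset.sum_le_sum fun t _ => mixDist_le_two hP hqs t s).trans_eq ?_
      simp [mul_comm]
    · rw [Finset.mul_sum]
      exact Finset.sum_le_sum fun t _ => by
        rw [add_comm]; exact mixDist_add_le hP hqs hq h t s
  have h2 : ∑ t ∈ Finset.range n, mixDist P q t s ≤ ∑ t ∈ Finset.range (m + n), mixDist P q t s :=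
    Finset.sum_le_sum_of_subset_of_nonneg (Finset.range_mono (Nat.le_add_left n m))
      fun t _ _ => mixDist_nonneg t s
  have : (0 : ℝ) ≤ m := Nat.cast_nonneg m
  linarith

lemma summable_mixDist (hP : P ∈ rowStochastic ℝ S) (hqs : q ∈ stdSimplex ℝ S)
    (hq : q ᵥ* P = q) {m : ℕ} (h : ∀ i, mixDist P q m i ≤ 1 / 4) (s : S) :
    Summable fun t => mixDist P q t s :=
  summable_of_sum_range_le (fun t => mixDist_nonneg t s) fun n => sum_mixDist_le hP hqs hq h n s

lemma abs_pow_mulVec_sub_le (f : S → ℝ) {c : ℝ} (hf : ∀ s, |f s| ≤ c) (t : ℕ) (s : S) :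
    |(P ^ t *ᵥ f) s - q ⬝ᵥ f| ≤ c * mixDist P q t s := by
  simp only [Matrix.mulVec, dotProduct, ← Finset.sum_sub_distrib, ← sub_mul, mixDist,
    Finset.mul_sum]
  refine (Finset.abs_sum_le_sum_abs _ _).trans (Finset.sum_le_sum fun i _ => ?_)
  rw [abs_mul, mul_comm]
  exact mul_le_mul_of_nonneg_right (hf i) (abs_nonneg _)

/-- The potential `∑ₜ (Pᵗ f - q f)` of a function `f`. -/
def potential (P : Matrix S S ℝ) (q f : S → ℝ) (s : S) : ℝ :=
  ∑' t : ℕ, ((P ^ t *ᵥ f) s - q ⬝ᵥ f)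

lemma summable_potential (hP : P ∈ rowStochastic ℝ S) (hqs : q ∈ stdSimplex ℝ S)
    (hq : q ᵥ* P = q) {m : ℕ} (h : ∀ i, mixDist P q m i ≤ 1 / 4) (f : S → ℝ) (s : S) :
    Summable fun t : ℕ => (P ^ t *ᵥ f) s - q ⬝ᵥ f :=
  Summable.of_norm_bounded
    ((summable_mixDist hP hqs hq h s).mul_left (∑ i, |f i|)) fun t =>
    abs_pow_mulVec_sub_le f (fun i => Finset.single_le_sum (f := fun i => |f i|)
      (fun _ _ => abs_nonneg _) (Finset.mem_univ i)) t s

lemma abs_potential_le (hP : P ∈ rowStochastic ℝ S) (hqs : q ∈ stdSimplex ℝ S)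
    (hq : q ᵥ* P = q) {m : ℕ} (h : ∀ i, mixDist P q m i ≤ 1 / 4) {f : S → ℝ} {c : ℝ}
    (hc : 0 ≤ c) (hf : ∀ s, |f s| ≤ c) (s : S) : |potential P q f s| ≤ 3 * m * c := by
  have hs := summable_mixDist hP hqs hq h s
  have := tsum_of_norm_bounded (hs.mul_left c).hasSum fun t =>
    (Real.norm_eq_abs _).trans_le (abs_pow_mulVec_sub_le (P := P) (q := q) f hf t s)
  rw [Real.norm_eq_abs, tsum_mul_left] at this
  refine this.trans ?_
  rw [mul_comm c]
  exact mul_le_mul_of_nonneg_right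
    (hs.tsum_le_of_sum_range_le fun n => sum_mixDist_le hP hqs hq h n s) hc

/-- The Poisson equation. -/
lemma potential_eq (hP : P ∈ rowStochastic ℝ S) (hqs : q ∈ stdSimplex ℝ S)
    (hq : q ᵥ* P = q) {m : ℕ} (h : ∀ i, mixDist P q m i ≤ 1 / 4) (f : S → ℝ) (s : S) :
    potential P q f s = f s - q ⬝ᵥ f + (P *ᵥ potential P q f) s := by
  unfold potential
  rw [(summable_potential hP hqs hq h f s).tsum_eq_zero_add]
  simp only [pow_zero, Matrix.one_mulVec, add_right_inj]
  simp only [Matrix.mulVec, dotProduct]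
  have hterm : ∀ t : ℕ, ∑ i, (P ^ (t + 1)) s i * f i - ∑ i, q i * f i =
      ∑ j, P s j * (∑ i, (P ^ t) j i * f i - ∑ i, q i * f i) := fun t => by
    simp only [mul_sub, Finset.sum_sub_distrib, ← Finset.sum_mul,
      sum_row_of_mem_rowStochastic hP, one_mul]
    congr 1
    have := congrFun (Matrix.mulVec_mulVec f P (P ^ t)) s
    rw [← pow_succ'] at this
    exact this.symm
  simp only [hterm, ← tsum_mul_left]
  exact Summable.tsum_finsetSum fun j _ => (summable_potential hP hqs hq h f j).mul_left _

/-- Every term of the series is centred under the invariant law. This normalization fixes the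
additive constant that the Poisson equation leaves open. -/
lemma stationary_dotProduct_potential (hP : P ∈ rowStochastic ℝ S) (hqs : q ∈ stdSimplex ℝ S)
    (hq : q ᵥ* P = q) {m : ℕ} (h : ∀ i, mixDist P q m i ≤ 1 / 4) (f : S → ℝ) :
    q ⬝ᵥ potential P q f = 0 := by
  have : ∀ t : ℕ, ∑ s, q s * ((P ^ t *ᵥ f) s - q ⬝ᵥ f) = 0 := fun t => by
    simp only [mul_sub, Finset.sum_sub_distrib, ← Finset.sum_mul, hqs.2, one_mul]
    have h1 : q ⬝ᵥ (P ^ t *ᵥ f) = q ⬝ᵥ f := by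
      rw [Matrix.dotProduct_mulVec, stationary_pow hq]
    exact sub_eq_zero.2 h1
  calc q ⬝ᵥ potential P q f = ∑ s, ∑' t : ℕ, q s * ((P ^ t *ᵥ f) s - q ⬝ᵥ f) :=
        Finset.sum_congr rfl fun s _ => tsum_mul_left.symm
    _ = ∑' t : ℕ, ∑ s, q s * ((P ^ t *ᵥ f) s - q ⬝ᵥ f) :=
        (Summable.tsum_finsetSum fun j _ =>
          (summable_potential hP hqs hq h f j).mul_left _).symm
    _ = 0 := by simp only [this, tsum_zero]

/-- A solution of a Poisson equation is bounded, up to a constant, in terms of the mixing time. -/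
lemma abs_sub_le_of_poisson (hP : P ∈ rowStochastic ℝ S) (hqs : q ∈ stdSimplex ℝ S)
    (hq : q ᵥ* P = q) {m : ℕ} (h : ∀ i, mixDist P q m i ≤ 1 / 4) {f w : S → ℝ} {c κ : ℝ}
    (hc : 0 ≤ c) (hf : ∀ s, |f s| ≤ c) (hw : ∀ s, w s = f s - κ + (P *ᵥ w) s) (s : S) :
    |w s - q ⬝ᵥ w| ≤ 3 * m * c := by
  have hκ : q ⬝ᵥ f = κ := by
    have h1 : q ⬝ᵥ w = q ⬝ᵥ (P *ᵥ w) := by rw [Matrix.dotProduct_mulVec, hq]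
    have h2 : q ⬝ᵥ w = q ⬝ᵥ f - κ + q ⬝ᵥ (P *ᵥ w) := by
      conv_lhs => rw [show w = fun s => f s - κ + (P *ᵥ w) s from funext hw]
      simp only [dotProduct, mul_add, mul_sub, Finset.sum_add_distrib, Finset.sum_sub_distrib,
        ← Finset.sum_mul, hqs.2, one_mul]
    linarith
  -- Iterating the equation `n` times telescopes. The remainder `P ^ n *ᵥ w` tends to the mean of
  -- `w`, while the partial sums are bounded uniformly in `n`.
  have hn : ∀ n : ℕ, ∀ s, ∑ t ∈ Finset.range n, ((P ^ t *ᵥ f) s - q ⬝ᵥ f) =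
      w s - (P ^ n *ᵥ w) s := fun n => by
    induction n with
    | zero => simp
    | succ n ih =>
      intro s
      rw [Finset.sum_range_succ, ih, hκ]
      have h3 : P ^ n *ᵥ w = P ^ n *ᵥ f - (fun _ => κ) + P ^ (n + 1) *ᵥ w := by
        conv_lhs => rw [show w = f - (fun _ => κ) + P *ᵥ w from funext hw]
        rw [Matrix.mulVec_add, Matrix.mulVec_sub, Matrix.mulVec_mulVec, ← pow_succ]
        congr 2
        funext i
        simp only [Matrix.mulVec, dotProduct, ← Finset.sum_mul, sum_row_pow hP, one_mul]
      have h4 := congrFun h3 s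
      simp only [Pi.add_apply, Pi.sub_apply] at h4
      linarith
  have hlim : Tendsto (fun n : ℕ => |w s - (P ^ n *ᵥ w) s|) atTop (𝓝 |w s - q ⬝ᵥ w|) := by
    refine (tendsto_const_nhds.sub ?_).abs
    have := (summable_potential hP hqs hq h w s).tendsto_atTop_zero.add_const (q ⬝ᵥ w)
    simpa using this
  refine le_of_tendsto' hlim fun n => ?_
  rw [← hn n s]
  calc |∑ t ∈ Finset.range n, ((P ^ t *ᵥ f) s - q ⬝ᵥ f)|
      ≤ ∑ t ∈ Finset.range n, c * mixDist P q t s :=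
        (Finset.abs_sum_le_sum_abs _ _).trans
          (Finset.sum_le_sum fun t _ => abs_pow_mulVec_sub_le f hf t s)
    _ ≤ 3 * m * c := by
        rw [← Finset.mul_sum, mul_comm]
        exact mul_le_mul_of_nonneg_right (sum_mixDist_le hP hqs hq h n s) hc

end Stationary

end Chain

section Values

/-! ### Stationary policies of an ergodic MDP -/

variable {S : Type u} {A : Type v} [Fintype S] [Fintype A] [DecidableEq S]

namespace MDP

variable {M : MDP S A} {π π' : S → A → ℝ}

lemma trans_mem_rowStochastic (hπ : IsPolicy π) : M.trans π ∈ rowStochastic ℝ S := by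
  refine mem_rowStochastic_iff_sum.2 ⟨fun i j => ?_, fun i => ?_⟩
  · exact Finset.sum_nonneg fun a _ => mul_nonneg ((M.P_mem i a).1 j) ((hπ i).1 a)
  · simp only [trans, Matrix.of_apply]
    rw [Finset.sum_comm]
    simp only [← Finset.sum_mul, (M.P_mem i _).2, one_mul, (hπ i).2]

lemma trans_mulVec (f : S → ℝ) (s : S) :
    (M.trans π *ᵥ f) s = ∑ a, π s a * ∑ s', M.P s a s' * f s' := by
  simp only [Matrix.mulVec, dotProduct, trans, Matrix.of_apply, Finset.sum_mul, Finset.mul_sum]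
  rw [Finset.sum_comm]
  exact Finset.sum_congr rfl fun a _ => Finset.sum_congr rfl fun s' _ => by ring

/-- Some power of the transition matrix is bounded below, uniformly over all policies. -/
lemma Ergodic.exists_minorization [Nonempty S] (hM : M.Ergodic) :
    ∃ δ > 0, ∃ n : ℕ, ∀ π, IsPolicy π → ∀ i j, δ ≤ (M.trans π ^ n) i j := by
  have hcont : Continuous fun π : S → A → ℝ => M.trans π := by
    refine continuous_matrix fun i j => ?_
    simp only [trans, Matrix.of_apply]
    fun_prop
  have hcomp : IsCompact {π : S → A → ℝ | IsPolicy π} := by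
    have : {π : S → A → ℝ | IsPolicy π} = Set.univ.pi fun _ => stdSimplex ℝ A := by
      ext π; simp [IsPolicy]
    rw [this]
    exact isCompact_univ_pi fun _ => isCompact_stdSimplex ℝ A
  -- The property passes to subsets and to unions (a lower bound survives higher powers, so two
  -- powers can be replaced by their maximum). It holds near each policy because the finitely many
  -- entries are continuous and positive there.
  have key := hcomp.induction_on (p := fun t => ∃ δ > 0, ∃ n : ℕ, ∀ π ∈ t, IsPolicy π →
    ∀ i j, δ ≤ (M.trans π ^ n) i j) ⟨1, one_pos, 0, by simp⟩
    (fun s t hst ⟨δ, hδ, n, h⟩ => ⟨δ, hδ, n, fun π hπ => h π (hst hπ)⟩)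
    (fun s t ⟨δ, hδ, n, h⟩ ⟨δ', hδ', n', h'⟩ => by
      refine ⟨min δ δ', lt_min hδ hδ', max n n', fun π hπ hpol i j => ?_⟩
      rcases hπ with hπ | hπ
      · exact (min_le_left _ _).trans
          (le_pow_entry (trans_mem_rowStochastic hpol) (h π hπ hpol) (le_max_left _ _) i j)
      · exact (min_le_right _ _).trans
          (le_pow_entry (trans_mem_rowStochastic hpol) (h' π hπ hpol) (le_max_right _ _) i j))
    (fun π hπ => by
      obtain ⟨n, hn⟩ := exists_pow_pos (trans_mem_rowStochastic hπ) (hM π hπ).1 (hM π hπ).2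
      obtain ⟨⟨i₀, j₀⟩, -, hmin⟩ := Finset.exists_min_image (Finset.univ : Finset (S × S))
        (fun x => (M.trans π ^ n) x.1 x.2) Finset.univ_nonempty
      refine ⟨{π' | ∀ i j, (M.trans π ^ n) i₀ j₀ / 2 < (M.trans π' ^ n) i j},
        mem_nhdsWithin_of_mem_nhds ?_, _, half_pos (hn i₀ j₀), n,
        fun π' hπ' _ i j => (hπ' i j).le⟩
      simp only [Set.ofPred_forall, Filter.iInter_mem]
      intro i j
      have hc : Continuous fun π' : S → A → ℝ => (M.trans π' ^ n) i j :=
        (hcont.pow n).matrix_elem i j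
      exact (hc.tendsto π).eventually (lt_mem_nhds
        ((half_lt_self (hn i₀ j₀)).trans_le (hmin (i, j) (Finset.mem_univ _)))))
  obtain ⟨δ, hδ, n, h⟩ := key
  exact ⟨δ, hδ, n, fun π hπ => h π hπ hπ⟩

/-! ### Uniform mixing, Bellman equations and the performance difference. -/

section StatDist

variable [Nonempty S]

lemma isStationary_statDist (hπ : IsPolicy π) : M.IsStationary π (M.statDist π) :=
  Classical.epsilon_spec (p := M.IsStationary π) (exists_stationary (trans_mem_rowStochastic hπ))

/-- A time after which the chains of all policies are mixed. -/
lemma Ergodic.exists_mixed (hM : M.Ergodic) :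
    ∃ K : ℕ, 1 ≤ K ∧ ∀ π, IsPolicy π → ∀ s, mixDist (M.trans π) (M.statDist π) K s ≤ 1 / 4 := by
  obtain ⟨δ, hδ, n, h⟩ := hM.exists_minorization
  -- Capping `δ` at `1 / |S|` keeps the contraction factor in `[0, 1)`.
  have hlt : 1 - Fintype.card S * min δ (Fintype.card S : ℝ)⁻¹ < 1 := by
    have : (0 : ℝ) < Fintype.card S := Nat.cast_pos.2 Fintype.card_pos
    have : 0 < min δ (Fintype.card S : ℝ)⁻¹ := lt_min hδ (inv_pos.2 this)
    nlinarith
  have h0 : 0 ≤ 1 - Fintype.card S * min δ (Fintype.card S : ℝ)⁻¹ := by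
    have hc : (0 : ℝ) < Fintype.card S := Nat.cast_pos.2 Fintype.card_pos
    have := mul_le_mul_of_nonneg_left (min_le_right δ (Fintype.card S : ℝ)⁻¹) hc.le
    rw [mul_inv_cancel₀ hc.ne'] at this
    linarith
  -- The initial `ℓ¹` distance may be `2`, so a factor `1/8` is needed to reach `1/4`.
  obtain ⟨k, hk⟩ := exists_pow_lt_of_lt_one (show (0 : ℝ) < 1 / 8 by norm_num) hlt
  refine ⟨(n + 1) * (k + 1), Nat.mul_pos n.succ_pos k.succ_pos, fun π hπ s => ?_⟩
  have hP := trans_mem_rowStochastic (M := M) hπ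
  obtain ⟨hqs, hq⟩ := isStationary_statDist (M := M) hπ
  have := mixDist_mul_le hP hqs hq (δ := min δ (Fintype.card S : ℝ)⁻¹) (n := n + 1)
    (fun i j => (min_le_left _ _).trans (le_pow_entry hP (h π hπ) n.le_succ i j)) (k + 1) s
  have h2 := pow_le_pow_of_le_one h0 hlt.le (Nat.le_add_right k 1)
  linarith

/-- Ergodicity makes the defining set nonempty, so the infimum is attained and is not the default
value `0`. -/
lemma mixTimeOf_spec (hM : M.Ergodic) (hπ : IsPolicy π) :
    1 ≤ M.mixTimeOf π ∧ ∀ s, mixDist (M.trans π) (M.statDist π) (M.mixTimeOf π) s ≤ 1 / 4 := by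
  obtain ⟨K, hK, h⟩ := hM.exists_mixed
  exact Nat.sInf_mem (s := {t : ℕ | 1 ≤ t ∧
    ∀ s, ∑ s', |(M.trans π ^ t) s s' - M.statDist π s'| ≤ 1 / 4}) ⟨K, hK, h π hπ⟩

/-- A mixing time common to all policies bounds the family, so the supremum is not a default value.
-/
lemma mixTimeOf_le_mixTime (hM : M.Ergodic) {d : ℕ} {pol : Param d → S → A → ℝ}
    (hpol : ∀ θ, IsPolicy (pol θ)) (θ : Param d) : M.mixTimeOf (pol θ) ≤ M.mixTime pol := by
  obtain ⟨K, hK, h⟩ := hM.exists_mixed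
  exact le_ciSup (f := fun θ => M.mixTimeOf (pol θ))
    ⟨K, Set.forall_mem_range.2 fun θ => Nat.sInf_le ⟨hK, h _ (hpol θ)⟩⟩ θ

lemma one_le_mixTime (hM : M.Ergodic) {d : ℕ} {pol : Param d → S → A → ℝ}
    (hpol : ∀ θ, IsPolicy (pol θ)) : 1 ≤ M.mixTime pol :=
  (mixTimeOf_spec hM (hpol 0)).1.trans (mixTimeOf_le_mixTime hM hpol 0)

/-- The uniform minorization bounds all stationary probabilities below by `δ`, hence both suprema
are over bounded families; each reciprocal probability is at least one. -/
lemma one_le_hitTime (hM : M.Ergodic) {d : ℕ} {pol : Param d → S → A → ℝ}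
    (hpol : ∀ θ, IsPolicy (pol θ)) : 1 ≤ M.hitTime pol := by
  obtain ⟨δ, hδ, n, h⟩ := hM.exists_minorization
  have hpos : ∀ θ s, δ ≤ M.statDist (pol θ) s := fun θ s =>
    le_stationary (isStationary_statDist (hpol θ)).1 (isStationary_statDist (hpol θ)).2
      (h _ (hpol θ)) s
  have hle : ∀ θ, M.hitTimeOf (pol θ) ≤ 1 / δ := fun θ =>
    ciSup_le fun s => one_div_le_one_div_of_le hδ (hpos θ s)
  let s : S := Classical.arbitrary S
  calc (1 : ℝ) ≤ 1 / M.statDist (pol 0) s := by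
        rw [le_div_iff₀ (hδ.trans_le (hpos 0 s)), one_mul]
        have hq := (isStationary_statDist (M := M) (hpol 0)).1
        rw [← hq.2]
        exact Finset.single_le_sum (fun i _ => hq.1 i) (Finset.mem_univ s)
    _ ≤ M.hitTimeOf (pol 0) :=
        le_ciSup (f := fun s => 1 / M.statDist (pol 0) s) (Set.finite_range _).bddAbove s
    _ ≤ M.hitTime pol :=
        le_ciSup (f := fun θ => M.hitTimeOf (pol θ)) ⟨1 / δ, Set.forall_mem_range.2 hle⟩ 0

lemma avgReward_eq : M.avgReward π = M.statDist π ⬝ᵥ M.polReward π := by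
  simp only [avgReward, dotProduct, polReward, Finset.mul_sum]
  exact Finset.sum_congr rfl fun s _ => Finset.sum_congr rfl fun a _ => by ring

lemma V_eq_potential : M.V π = potential (M.trans π) (M.statDist π) (M.polReward π) := by
  funext s
  simp only [V, potential, avgReward_eq]

lemma abs_sum_policy_le {p : A → ℝ} (hp : p ∈ stdSimplex ℝ A) {f : A → ℝ} {c : ℝ}
    (hf : ∀ a, |f a| ≤ c) : |∑ a, p a * f a| ≤ c := by
  calc |∑ a, p a * f a| ≤ ∑ a, p a * c := (Finset.abs_sum_le_sum_abs _ _).trans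
        (Finset.sum_le_sum fun a _ => by
          rw [abs_mul, abs_of_nonneg (hp.1 a)]
          exact mul_le_mul_of_nonneg_left (hf a) (hp.1 a))
    _ = c := by rw [← Finset.sum_mul, hp.2, one_mul]

lemma abs_r_le (s : S) (a : A) : |M.r s a| ≤ 1 := by
  rw [abs_of_nonneg (M.r_mem s a).1]; exact (M.r_mem s a).2

lemma abs_polReward_le (hπ : IsPolicy π) (s : S) : |M.polReward π s| ≤ 1 := by
  simpa only [polReward, mul_comm] using abs_sum_policy_le (hπ s) (M.abs_r_le s)

lemma avgReward_mem (hπ : IsPolicy π) : M.avgReward π ∈ Set.Icc (0 : ℝ) 1 := by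
  have hq := (isStationary_statDist (M := M) hπ).1
  rw [avgReward_eq]
  refine ⟨Finset.sum_nonneg fun s _ => mul_nonneg (hq.1 s) (Finset.sum_nonneg fun a _ =>
    mul_nonneg (M.r_mem s a).1 ((hπ s).1 a)), ?_⟩
  exact (le_abs_self _).trans (abs_sum_policy_le hq (abs_polReward_le hπ))

lemma abs_V_le (hM : M.Ergodic) (hπ : IsPolicy π) (s : S) : |M.V π s| ≤ 3 * M.mixTimeOf π := by
  obtain ⟨hqs, hq⟩ := isStationary_statDist (M := M) hπ
  rw [V_eq_potential]
  simpa using abs_potential_le (trans_mem_rowStochastic hπ) hqs hq (mixTimeOf_spec hM hπ).2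
    zero_le_one (abs_polReward_le hπ) s

lemma abs_V_le_mixTime (hM : M.Ergodic) {d : ℕ} {pol : Param d → S → A → ℝ}
    (hpol : ∀ θ, IsPolicy (pol θ)) (θ : Param d) (s : S) :
    |M.V (pol θ) s| ≤ 3 * M.mixTime pol :=
  (abs_V_le hM (hpol θ) s).trans (by
    gcongr
    exact mixTimeOf_le_mixTime hM hpol θ)

/-- The Bellman equation. -/
lemma V_bellman (hM : M.Ergodic) (hπ : IsPolicy π) (s : S) :
    M.V π s = M.polReward π s - M.avgReward π + (M.trans π *ᵥ M.V π) s := by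
  obtain ⟨hqs, hq⟩ := isStationary_statDist (M := M) hπ
  rw [V_eq_potential, avgReward_eq]
  exact potential_eq (trans_mem_rowStochastic hπ) hqs hq (mixTimeOf_spec hM hπ).2 _ s

lemma Q_eq (hM : M.Ergodic) (hπ : IsPolicy π) (s : S) (a : A) :
    M.Q π s a = M.r s a - M.avgReward π + ∑ s', M.P s a s' * M.V π s' := by
  obtain ⟨hqs, hq⟩ := isStationary_statDist (M := M) hπ
  have hsum : ∀ s', Summable fun t : ℕ => (M.trans π ^ t *ᵥ M.polReward π) s' - M.avgReward π :=
    fun s' => by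
      rw [avgReward_eq]
      exact summable_potential (trans_mem_rowStochastic hπ) hqs hq (mixTimeOf_spec hM hπ).2 _ s'
  have hterm : ∀ t, M.expReward π s a (t + 1) - M.avgReward π =
      ∑ s', M.P s a s' * ((M.trans π ^ t *ᵥ M.polReward π) s' - M.avgReward π) := fun t => by
    simp only [expReward, mul_sub, Finset.sum_sub_distrib, ← Finset.sum_mul, (M.P_mem s a).2,
      one_mul]
  have hs : Summable fun t => M.expReward π s a (t + 1) - M.avgReward π := by
    simp only [hterm]
    exact summable_sum fun s' _ => (hsum s').mul_left _
  have hs' : Summable fun t => M.expReward π s a t - M.avgReward π :=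
    (summable_nat_add_iff (f := fun t => M.expReward π s a t - M.avgReward π) 1).1 hs
  rw [Q, hs'.tsum_eq_zero_add, tsum_congr hterm,
    Summable.tsum_finsetSum fun s' _ => (hsum s').mul_left _]
  simp only [tsum_mul_left, V, expReward]

lemma sum_policy_mul_Q (hM : M.Ergodic) (hπ : IsPolicy π) (hπ' : IsPolicy π') (s : S) :
    ∑ a, π' s a * M.Q π s a =
      M.polReward π' s - M.avgReward π + (M.trans π' *ᵥ M.V π) s := by
  simp only [Q_eq hM hπ, mul_add, mul_sub, Finset.sum_add_distrib, Finset.sum_sub_distrib,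
    ← Finset.sum_mul, (hπ' s).2, one_mul, trans_mulVec, polReward]
  simp only [mul_comm]

lemma sum_policy_mul_Adv (hM : M.Ergodic) (hπ : IsPolicy π) (s : S) :
    ∑ a, π s a * M.Adv π s a = 0 := by
  simp only [Adv, mul_sub, Finset.sum_sub_distrib, ← Finset.sum_mul, (hπ s).2, one_mul,
    sum_policy_mul_Q hM hπ hπ]
  rw [← V_bellman hM hπ, sub_self]

/-- The performance difference lemma. -/
lemma avgReward_sub (hM : M.Ergodic) (hπ : IsPolicy π) (hπ' : IsPolicy π') :
    M.avgReward π' - M.avgReward π =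
      ∑ s, M.statDist π' s * ∑ a, π' s a * M.Adv π s a := by
  obtain ⟨hqs, hq⟩ := isStationary_statDist (M := M) hπ'
  have h1 : M.statDist π' ⬝ᵥ (M.trans π' *ᵥ M.V π) = M.statDist π' ⬝ᵥ M.V π := by
    rw [Matrix.dotProduct_mulVec, hq]
  simp only [dotProduct] at h1
  simp only [Adv, mul_sub, Finset.sum_sub_distrib, ← Finset.sum_mul, (hπ' _).2, one_mul,
    sum_policy_mul_Q hM hπ hπ', mul_add, Finset.sum_add_distrib, h1, hqs.2]
  rw [avgReward_eq (π := π')]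
  simp only [dotProduct]
  ring

/-! ### Perturbation of the policy -/

lemma abs_sum_sub_policy_le {δ : ℝ} {s : S} (hδ : ∑ a, |π' s a - π s a| ≤ δ) {f : A → ℝ} {c : ℝ}
    (hc : 0 ≤ c) (hf : ∀ a, |f a| ≤ c) : |∑ a, π' s a * f a - ∑ a, π s a * f a| ≤ δ * c := by
  rw [← Finset.sum_sub_distrib]
  calc |∑ a, (π' s a * f a - π s a * f a)| ≤ ∑ a, |π' s a - π s a| * c :=
        (Finset.abs_sum_le_sum_abs _ _).trans (Finset.sum_le_sum fun a _ => by
          rw [← sub_mul, abs_mul]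
          exact mul_le_mul_of_nonneg_left (hf a) (abs_nonneg _))
    _ ≤ δ * c := by rw [← Finset.sum_mul]; exact mul_le_mul_of_nonneg_right hδ hc

lemma abs_polReward_sub_le {δ : ℝ} {s : S} (hδ : ∑ a, |π' s a - π s a| ≤ δ) :
    |M.polReward π' s - M.polReward π s| ≤ δ := by
  simpa only [polReward, mul_comm, mul_one] using
    abs_sum_sub_policy_le hδ zero_le_one (M.abs_r_le s)

lemma abs_trans_mulVec_sub_le {δ : ℝ} {s : S} (hδ : ∑ a, |π' s a - π s a| ≤ δ) {f : S → ℝ}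
    {c : ℝ} (hc : 0 ≤ c) (hf : ∀ s, |f s| ≤ c) :
    |(M.trans π' *ᵥ f) s - (M.trans π *ᵥ f) s| ≤ δ * c := by
  simp only [trans_mulVec]
  exact abs_sum_sub_policy_le hδ hc fun a => abs_sum_policy_le (M.P_mem s a) hf

/-- Lipschitz dependence of stationary expectations on the policy. -/
lemma abs_statDist_dotProduct_sub_le (hM : M.Ergodic) (hπ : IsPolicy π) (hπ' : IsPolicy π')
    {δ : ℝ} (hδ : ∀ s, ∑ a, |π' s a - π s a| ≤ δ) {f : S → ℝ} {c : ℝ} (hc : 0 ≤ c)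
    (hf : ∀ s, |f s| ≤ c) :
    |M.statDist π' ⬝ᵥ f - M.statDist π ⬝ᵥ f| ≤ δ * (3 * M.mixTimeOf π * c) := by
  obtain ⟨hqs, hq⟩ := isStationary_statDist (M := M) hπ
  obtain ⟨hqs', hq'⟩ := isStationary_statDist (M := M) hπ'
  have hP := trans_mem_rowStochastic (M := M) hπ
  have hmix := (mixTimeOf_spec hM hπ).2
  set U := potential (M.trans π) (M.statDist π) f with hU
  have hUle : ∀ s, |U s| ≤ 3 * M.mixTimeOf π * c := abs_potential_le hP hqs hq hmix hc hf
  have h1 : M.statDist π' ⬝ᵥ (M.trans π' *ᵥ U) = M.statDist π' ⬝ᵥ U := by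
    rw [Matrix.dotProduct_mulVec, hq']
  have h2 : M.statDist π' ⬝ᵥ U = M.statDist π' ⬝ᵥ f - M.statDist π ⬝ᵥ f +
      M.statDist π' ⬝ᵥ (M.trans π *ᵥ U) := by
    conv_lhs => rw [show U = fun s => f s - M.statDist π ⬝ᵥ f + (M.trans π *ᵥ U) s from
      funext (potential_eq hP hqs hq hmix f)]
    simp only [dotProduct, mul_add, mul_sub, Finset.sum_add_distrib, Finset.sum_sub_distrib,
      ← Finset.sum_mul, hqs'.2, one_mul]
  -- The Poisson equation of `π` is integrated against the stationary law of `π'`, and invariance of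
  -- that law leaves only the difference of the two transition operators applied to `U`.
  have h3 : M.statDist π' ⬝ᵥ f - M.statDist π ⬝ᵥ f =
      ∑ s, M.statDist π' s * ((M.trans π' *ᵥ U) s - (M.trans π *ᵥ U) s) := by
    simp only [mul_sub, Finset.sum_sub_distrib]
    simp only [dotProduct] at h1 h2 ⊢
    linarith
  rw [h3]
  exact abs_sum_policy_le hqs' fun s =>
    abs_trans_mulVec_sub_le (hδ s) (by positivity) hUle

lemma abs_avgReward_sub_le (hM : M.Ergodic) (hπ : IsPolicy π) (hπ' : IsPolicy π')
    {δ : ℝ} (hδ : ∀ s, ∑ a, |π' s a - π s a| ≤ δ) :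
    |M.avgReward π' - M.avgReward π| ≤ (1 + 3 * M.mixTimeOf π) * δ := by
  have h1 := abs_statDist_dotProduct_sub_le hM hπ hπ' hδ zero_le_one (abs_polReward_le (M := M) hπ)
  have h2 : |M.statDist π' ⬝ᵥ M.polReward π' - M.statDist π' ⬝ᵥ M.polReward π| ≤ δ := by
    simp only [dotProduct, ← Finset.sum_sub_distrib, ← mul_sub]
    exact abs_sum_policy_le (isStationary_statDist hπ').1 fun s => abs_polReward_sub_le (hδ s)
  rw [avgReward_eq, avgReward_eq]
  have h3 := abs_sub_le (M.statDist π' ⬝ᵥ M.polReward π') (M.statDist π' ⬝ᵥ M.polReward π)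
    (M.statDist π ⬝ᵥ M.polReward π)
  linarith

/-- Lipschitz dependence of the value function on the policy. -/
lemma abs_V_sub_le (hM : M.Ergodic) (hπ : IsPolicy π) (hπ' : IsPolicy π') {m : ℕ} (hm : 1 ≤ m)
    (hπm : M.mixTimeOf π ≤ m) (hπm' : M.mixTimeOf π' ≤ m)
    {δ : ℝ} (hδ : ∀ s, ∑ a, |π' s a - π s a| ≤ δ) (s : S) :
    |M.V π' s - M.V π s| ≤ 21 * m ^ 2 * δ := by
  have hδ0 : 0 ≤ δ := (Finset.sum_nonneg fun _ _ => abs_nonneg _).trans (hδ s)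
  have hm1 : (1 : ℝ) ≤ m := by exact_mod_cast hm
  have hπm : (M.mixTimeOf π : ℝ) ≤ m := by exact_mod_cast hπm
  have hπm' : (M.mixTimeOf π' : ℝ) ≤ m := by exact_mod_cast hπm'
  obtain ⟨hqs, hq⟩ := isStationary_statDist (M := M) hπ
  obtain ⟨hqs', hq'⟩ := isStationary_statDist (M := M) hπ'
  have hV : ∀ s, |M.V π s| ≤ 3 * m := fun s => (abs_V_le hM hπ s).trans (by linarith)
  -- Subtracting the two Bellman equations yields a Poisson equation for the chain of `π'`, with
  -- source made of the change of rewards and the change of transitions applied to `V π`. Its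
  -- solution is controlled up to its mean, which is minus the mean of `V π` under the law of `π'`.
  have h1 := abs_sub_le_of_poisson (trans_mem_rowStochastic hπ') hqs' hq'
    (mixTimeOf_spec hM hπ').2 (w := fun s => M.V π' s - M.V π s)
    (f := fun s => (M.polReward π' s - M.polReward π s) +
      ((M.trans π' *ᵥ M.V π) s - (M.trans π *ᵥ M.V π) s))
    (κ := M.avgReward π' - M.avgReward π) (c := δ + δ * (3 * m)) (by positivity)
    (fun s => (abs_add_le _ _).trans (add_le_add (abs_polReward_sub_le (hδ s))
      (abs_trans_mulVec_sub_le (hδ s) (by positivity) hV)))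
    (fun s => by
      have h := congrFun (Matrix.mulVec_sub (M.trans π') (M.V π') (M.V π)) s
      have e : (M.V π' - M.V π) = fun s => M.V π' s - M.V π s := rfl
      rw [e] at h
      rw [h, Pi.sub_apply]
      linarith [V_bellman hM hπ s, V_bellman hM hπ' s]) s
  have h2 := abs_statDist_dotProduct_sub_le hM hπ hπ' hδ (by positivity) hV
  have h3 : M.statDist π ⬝ᵥ M.V π = 0 := by
    rw [V_eq_potential]
    exact stationary_dotProduct_potential (trans_mem_rowStochastic hπ) hqs hq
      (mixTimeOf_spec hM hπ).2 _
  have h4 : M.statDist π' ⬝ᵥ M.V π' = 0 := by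
    rw [V_eq_potential]
    exact stationary_dotProduct_potential (trans_mem_rowStochastic hπ') hqs' hq'
      (mixTimeOf_spec hM hπ').2 _
  have h5 : M.statDist π' ⬝ᵥ (fun s => M.V π' s - M.V π s) = -(M.statDist π' ⬝ᵥ M.V π) := by
    rw [show (fun s => M.V π' s - M.V π s) = M.V π' - M.V π from rfl, dotProduct_sub, h4, zero_sub]
  rw [h5] at h1
  rw [h3, sub_zero] at h2
  -- The fluctuation contributes `(3m + 9m²)δ` and the mean `9m²δ`; with `m ≤ m²` the total is
  -- `21m²δ`.
  have h6 : 3 * (M.mixTimeOf π' : ℝ) * (δ + δ * (3 * m)) ≤ 3 * m * (δ + δ * (3 * m)) := by gcongr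
  have h7 : δ * (3 * (M.mixTimeOf π : ℝ) * (3 * m)) ≤ δ * (3 * m * (3 * m)) := by gcongr
  have h8 : (m : ℝ) * δ ≤ m ^ 2 * δ := by
    rw [sq]; exact mul_le_mul_of_nonneg_right (le_mul_of_one_le_left (by positivity) hm1) hδ0
  have h9 := abs_add_le (M.V π' s - M.V π s - -(M.statDist π' ⬝ᵥ M.V π))
    (-(M.statDist π' ⬝ᵥ M.V π))
  rw [abs_neg, sub_add_cancel] at h9
  nlinarith

end StatDist

end MDP

end Values

section Gradient

/-! ### Parametrized policies -/

variable {S : Type u} {A : Type v} [Fintype S] [Fintype A] [DecidableEq S] [Nonempty S]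
variable {d : ℕ} {pol : Param d → S → A → ℝ} {G B : ℝ} {M : MDP S A}

namespace Regular

/-- Positivity allows writing the policy as the exponential of its logarithm, whose gradient is the
score. -/
lemma hasDerivAt_pol (h : Regular pol G B) (θ v : Param d) (s : S) (a : A) (t : ℝ) :
    HasDerivAt (fun u : ℝ => pol (θ + u • v) s a)
      (pol (θ + t • v) s a * inner ℝ (score pol (θ + t • v) s a) v) t := by
  have hg := ((h.diff s a) (θ + t • v)).hasGradientAt.hasFDerivAt
  have hl : HasDerivAt (fun u : ℝ => θ + u • v) v t := by
    simpa using ((hasDerivAt_id t).smul_const v).const_add θ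
  have hexp := (hg.comp_hasDerivAt t hl).exp
  simp only [Function.comp_def, Real.exp_log (h.pos _ s a)] at hexp
  simpa [score] using hexp

lemma G_nonneg [Nonempty A] (h : Regular pol G B) : 0 ≤ G :=
  (norm_nonneg _).trans
    (h.norm_score_le 0 (Classical.arbitrary S) (Classical.arbitrary A))

/-- The policies are Lipschitz in the `ℓ¹` distance. -/
lemma sum_abs_sub_le (h : Regular pol G B) (θ θ' : Param d) (s : S) :
    ∑ a, |pol θ' s a - pol θ s a| ≤ G * ‖θ' - θ‖ := by
  -- Freezing the signs at the endpoints turns the `ℓ¹` distance into the increment `f 1 - f 0` of a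
  -- differentiable function, whose derivative is an average of scores under a probability vector.
  let σ : A → ℝ := fun a => SignType.sign (pol θ' s a - pol θ s a)
  have hσ : ∀ a, |σ a| ≤ 1 := fun a => by
    rcases lt_trichotomy (pol θ' s a - pol θ s a) 0 with h | h | h <;> simp [σ, h]
  let f : ℝ → ℝ := fun t => ∑ a, σ a * pol (θ + t • (θ' - θ)) s a
  have hf : ∀ t, HasDerivAt f (∑ a, σ a * (pol (θ + t • (θ' - θ)) s a *
      inner ℝ (score pol (θ + t • (θ' - θ)) s a) (θ' - θ))) t := fun t =>
    HasDerivAt.fun_sum fun a _ => (h.hasDerivAt_pol θ (θ' - θ) s a t).const_mul _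
  have hbound := norm_image_sub_le_of_norm_deriv_le_segment_01' (f := f) (C := G * ‖θ' - θ‖)
    (fun t _ => (hf t).hasDerivWithinAt) fun t _ => by
      have := MDP.abs_sum_policy_le (h.isPolicy (θ + t • (θ' - θ)) s)
        (f := fun a => σ a * inner ℝ (score pol (θ + t • (θ' - θ)) s a) (θ' - θ))
        (c := G * ‖θ' - θ‖) fun a => by
          rw [abs_mul]
          calc _ ≤ 1 * (‖score pol (θ + t • (θ' - θ)) s a‖ * ‖θ' - θ‖) :=
                mul_le_mul (hσ a) (abs_real_inner_le_norm _ _) (abs_nonneg _) zero_le_one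
            _ ≤ _ := by
                rw [one_mul]
                exact mul_le_mul_of_nonneg_right (h.norm_score_le _ s a) (norm_nonneg _)
      rw [Real.norm_eq_abs]
      convert this using 3
      ring
  have hval : f 1 - f 0 = ∑ a, |pol θ' s a - pol θ s a| := by
    simp only [f, ← Finset.sum_sub_distrib, ← mul_sub, one_smul, zero_smul, add_zero,
      add_sub_cancel]
    exact Finset.sum_congr rfl fun a _ => sign_mul_self _
  rw [hval, Real.norm_eq_abs] at hbound
  exact (le_abs_self _).trans hbound

lemma continuous_J [Nonempty A] (h : Regular pol G B) (hM : M.Ergodic) :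
    Continuous (M.J pol) := by
  refine continuous_iff_continuousAt.2 fun θ => ?_
  refine tendsto_iff_norm_sub_tendsto_zero.2 (squeeze_zero (fun _ => norm_nonneg _)
    (fun θ' => MDP.abs_avgReward_sub_le hM (h.isPolicy θ) (h.isPolicy θ')
      (h.sum_abs_sub_le θ θ')) ?_)
  have : Tendsto (fun θ' => (1 + 3 * (M.mixTimeOf (pol θ) : ℝ)) * (G * ‖θ' - θ‖)) (𝓝 θ)
      (𝓝 ((1 + 3 * (M.mixTimeOf (pol θ) : ℝ)) * (G * ‖θ - θ‖))) :=
    Continuous.tendsto (by fun_prop) θ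
  simpa using this

lemma tendsto_statDist [Nonempty A] (h : Regular pol G B) (hM : M.Ergodic) (θ : Param d) (s : S) :
    Tendsto (fun θ' => M.statDist (pol θ') s) (𝓝 θ) (𝓝 (M.statDist (pol θ) s)) := by
  refine tendsto_iff_norm_sub_tendsto_zero.2 (squeeze_zero (fun _ => norm_nonneg _)
    (fun θ' => ?_) (g := fun θ' => G * ‖θ' - θ‖ * (3 * M.mixTimeOf (pol θ) * 1)) ?_)
  · have := MDP.abs_statDist_dotProduct_sub_le hM (h.isPolicy θ) (h.isPolicy θ')
      (h.sum_abs_sub_le θ θ') zero_le_one (f := Pi.single s 1) fun i => by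
        rcases eq_or_ne i s with rfl | hi <;> simp [*]
    simpa using this
  · have : Tendsto (fun θ' => G * ‖θ' - θ‖ * (3 * (M.mixTimeOf (pol θ) : ℝ) * 1)) (𝓝 θ)
      (𝓝 (G * ‖θ - θ‖ * (3 * (M.mixTimeOf (pol θ) : ℝ) * 1))) :=
      Continuous.tendsto (by fun_prop) θ
    simpa using this

end Regular

/-- The policy gradient `E[A^π(s,a) ∇ log π(a|s)]` under the stationary law. -/
def policyGradient (pol : Param d → S → A → ℝ) (M : MDP S A) (θ : Param d) : Param d :=
  ∑ s, ∑ a, (M.statDist (pol θ) s * pol θ s a * M.Adv (pol θ) s a) • score pol θ s a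

/-- The policy gradient theorem, for directional derivatives. -/
lemma Regular.hasDerivAt_J [Nonempty A] (h : Regular pol G B) (hM : M.Ergodic) (θ v : Param d) :
    HasDerivAt (fun t : ℝ => M.J pol (θ + t • v)) (inner ℝ (policyGradient pol M θ) v) 0 := by
  -- By the performance difference lemma the increment of `J` is `∑ d^{π_{θ+tv}}(s) ψ s t`. Since `ψ
  -- s 0 = 0`, continuity of the stationary distribution suffices; it need not be differentiated.
  let ψ : S → ℝ → ℝ := fun s t => ∑ a, pol (θ + t • v) s a * M.Adv (pol θ) s a
  have hψ0 : ∀ s, ψ s 0 = 0 := fun s => by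
    simpa [ψ] using MDP.sum_policy_mul_Adv hM (h.isPolicy θ) s
  have hψ : ∀ s, HasDerivAt (ψ s)
      (∑ a, pol θ s a * inner ℝ (score pol θ s a) v * M.Adv (pol θ) s a) 0 := fun s =>
    HasDerivAt.fun_sum fun a _ => by
      simpa using (h.hasDerivAt_pol θ v s a 0).mul_const (M.Adv (pol θ) s a)
  have hJ : ∀ t : ℝ, M.J pol (θ + t • v) - M.J pol θ =
      ∑ s, M.statDist (pol (θ + t • v)) s * ψ s t := fun t =>
    MDP.avgReward_sub hM (h.isPolicy θ) (h.isPolicy _)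
  have hd : ∀ s, Tendsto (fun t : ℝ => M.statDist (pol (θ + t • v)) s) (𝓝[≠] 0)
      (𝓝 (M.statDist (pol θ) s)) := fun s => by
    have hl : Tendsto (fun t : ℝ => θ + t • v) (𝓝[≠] 0) (𝓝 θ) := by
      have : Tendsto (fun t : ℝ => θ + t • v) (𝓝 0) (𝓝 (θ + (0 : ℝ) • v)) :=
        Continuous.tendsto (by fun_prop) 0
      simpa using this.mono_left nhdsWithin_le_nhds
    exact (h.tendsto_statDist hM θ s).comp hl
  rw [hasDerivAt_iff_tendsto_slope]
  have hlim := tendsto_finsetSum Finset.univ fun s _ =>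
    (hd s).mul (hasDerivAt_iff_tendsto_slope.1 (hψ s))
  convert hlim using 1
  · funext t
    simp only [slope_def_field, hψ0, sub_zero, zero_smul, add_zero, hJ, Finset.sum_div,
      mul_div_assoc]
  · simp only [policyGradient, sum_inner, real_inner_smul_left, Finset.mul_sum]
    congr 1
    exact Finset.sum_congr rfl fun s _ => Finset.sum_congr rfl fun a _ => by ring

/-- Near-critical points of arbitrarily small performance: a minimizer of
`J + δ ‖· - θ₀‖²` performs no better than `θ₀`. -/
lemma Regular.exists_near_critical [Nonempty A] (h : Regular pol G B) (hM : M.Ergodic)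
    (θ₀ : Param d) {δ : ℝ} (hδ : 0 < δ) :
    ∃ θ, M.J pol θ ≤ M.J pol θ₀ ∧ ‖policyGradient pol M θ‖ ≤ 2 * √δ := by
  have hJ0 : ∀ θ, M.J pol θ ∈ Set.Icc (0 : ℝ) 1 := fun θ => MDP.avgReward_mem (h.isPolicy θ)
  let f : Param d → ℝ := fun θ => M.J pol θ + δ * ‖θ - θ₀‖ ^ 2
  have hf : Continuous f := by
    have := h.continuous_J hM
    fun_prop
  have hcoer : Tendsto f (cocompact _) atTop := by
    have h1 : Tendsto (fun θ : Param d => ‖θ - θ₀‖) (cocompact _) atTop :=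
      tendsto_norm_cocompact_atTop.comp (Homeomorph.subRight θ₀).isClosedEmbedding.tendsto_cocompact
    have h2 := (tendsto_pow_atTop two_ne_zero).comp h1
    exact tendsto_atTop_mono (fun θ => le_add_of_nonneg_left (hJ0 θ).1)
      (h2.const_mul_atTop hδ)
  obtain ⟨θ, hθ⟩ := hf.exists_forall_le hcoer
  have hle : M.J pol θ + δ * ‖θ - θ₀‖ ^ 2 ≤ M.J pol θ₀ := by simpa [f] using hθ θ₀
  have hnn : 0 ≤ δ * ‖θ - θ₀‖ ^ 2 := by positivity
  refine ⟨θ, by linarith, ?_⟩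
  have hgrad : policyGradient pol M θ = -(2 * δ) • (θ - θ₀) := by
    refine ext_inner_right ℝ fun v => ?_
    have hq : HasDerivAt (fun t : ℝ => δ * ‖θ + t • v - θ₀‖ ^ 2)
        (δ * (2 * inner ℝ (θ - θ₀) v)) 0 := by
      have hl : HasDerivAt (fun t : ℝ => θ + t • v - θ₀) v 0 := by
        simpa using (((hasDerivAt_id (0 : ℝ)).smul_const v).const_add θ).sub_const θ₀
      simpa using hl.norm_sq.const_mul δ
    have hmin : IsLocalMin (fun t : ℝ => M.J pol (θ + t • v) + δ * ‖θ + t • v - θ₀‖ ^ 2) 0 :=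
      Eventually.of_forall fun t => by simpa [f] using hθ (θ + t • v)
    have := hmin.hasDerivAt_eq_zero ((h.hasDerivAt_J hM θ v).add hq)
    rw [real_inner_smul_left]
    linarith
  -- Since `J` takes values in `[0, 1]`, the penalty paid by the minimizer is at most one.
  have hsq : (√δ * ‖θ - θ₀‖) ^ 2 ≤ 1 := by
    rw [mul_pow, Real.sq_sqrt hδ.le]
    linarith [(hJ0 θ).1, (hJ0 θ₀).2]
  have h1 : √δ * ‖θ - θ₀‖ ≤ 1 := by
    rwa [sq_le_one_iff₀ (by positivity)] at hsq
  rw [hgrad, norm_smul, Real.norm_eq_abs, abs_neg, abs_of_pos (by positivity)]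
  calc 2 * δ * ‖θ - θ₀‖ = 2 * √δ * (√δ * ‖θ - θ₀‖) := by
        nth_rewrite 1 [← Real.mul_self_sqrt hδ.le]; ring
    _ ≤ 2 * √δ * 1 := by gcongr
    _ = 2 * √δ := mul_one _

/-! ### The natural policy gradient direction -/

/-- The Fisher information as a linear map. -/
def fisherMap (pol : Param d → S → A → ℝ) (M : MDP S A) (θ : Param d) : Param d →ₗ[ℝ] Param d :=
  ∑ s, ∑ a, (M.statDist (pol θ) s * pol θ s a) •
    (innerₛₗ ℝ (score pol θ s a)).smulRight (score pol θ s a)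

lemma inner_fisherMap (θ ω v : Param d) : inner ℝ (fisherMap pol M θ ω) v =
    ∑ s, ∑ a, M.statDist (pol θ) s * pol θ s a *
      (inner ℝ (score pol θ s a) ω * inner ℝ (score pol θ s a) v) := by
  simp only [fisherMap, LinearMap.sum_apply, LinearMap.smul_apply, LinearMap.smulRight_apply,
    innerₛₗ_apply_apply, sum_inner, real_inner_smul_left]

lemma FisherNondegenerate.le_inner {μ : ℝ} (hF : FisherNondegenerate pol M μ) (θ ω : Param d) :
    μ * ‖ω‖ ^ 2 ≤ inner ℝ (fisherMap pol M θ ω) ω := by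
  have h := (hF θ).dotProduct_mulVec_nonneg ω.ofLp
  rw [Matrix.sub_mulVec, dotProduct_sub, Matrix.smul_mulVec, Matrix.one_mulVec, dotProduct_smul]
    at h
  have h1 : star ω.ofLp ⬝ᵥ ω.ofLp = ‖ω‖ ^ 2 := by
    rw [← real_inner_self_eq_norm_sq, EuclideanSpace.inner_eq_star_dotProduct, dotProduct_comm]
  have h2 : star ω.ofLp ⬝ᵥ (fisher pol M θ *ᵥ ω.ofLp) = inner ℝ (fisherMap pol M θ ω) ω := by
    rw [inner_fisherMap]
    simp only [fisher, Matrix.sum_mulVec, Matrix.smul_mulVec, dotProduct_sum, dotProduct_smul,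
      smul_eq_mul, Matrix.vecMulVec_mulVec, EuclideanSpace.inner_eq_star_dotProduct]
    refine Finset.sum_congr rfl fun s _ => Finset.sum_congr rfl fun a _ => ?_
    simp [dotProduct_comm, mul_comm]
  rw [h1, h2, smul_eq_mul] at h
  linarith

/-- The natural policy gradient direction is controlled by the policy gradient. -/
lemma exists_isNPGDirection {μ : ℝ} (hμ : 0 < μ) (hF : FisherNondegenerate pol M μ)
    (hpol : ∀ θ, IsPolicy (pol θ)) (θ : Param d) :
    ∃ ω, IsNPGDirection pol M θ ω ∧ μ * ‖ω‖ ≤ ‖policyGradient pol M θ‖ := by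
  have hinj : Function.Injective (fisherMap pol M θ) := by
    refine (injective_iff_map_eq_zero _).2 fun ω hω => ?_
    have := hF.le_inner θ ω
    rw [hω, inner_zero_left] at this
    have h2 : ‖ω‖ ^ 2 ≤ 0 := nonpos_of_mul_nonpos_right this hμ
    simpa using h2
  -- The equation `F(θ) ω = ∇J(θ)` is the normal equation of the least squares problem. It cancels
  -- the cross term in the expansion around `ω`.
  obtain ⟨ω, hω⟩ := LinearMap.injective_iff_surjective.1 hinj (policyGradient pol M θ)
  refine ⟨ω, fun ω' => ?_, ?_⟩
  · have hcross : ∑ s, ∑ a, M.statDist (pol θ) s * pol θ s a *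
        ((inner ℝ (score pol θ s a) ω - M.Adv (pol θ) s a) *
          inner ℝ (score pol θ s a) (ω' - ω)) = 0 := by
      have h1 := inner_fisherMap (pol := pol) (M := M) θ ω (ω' - ω)
      rw [hω, policyGradient] at h1
      simp only [sum_inner, real_inner_smul_left] at h1
      rw [← sub_eq_zero.2 h1.symm, ← Finset.sum_sub_distrib]
      refine Finset.sum_congr rfl fun s _ => ?_
      rw [← Finset.sum_sub_distrib]
      exact Finset.sum_congr rfl fun a _ => by ring
    have hexp : approxError pol M (M.statDist (pol θ)) (pol θ) ω' θ =
        approxError pol M (M.statDist (pol θ)) (pol θ) ω θ +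
        ∑ s, ∑ a, M.statDist (pol θ) s * pol θ s a *
          inner ℝ (score pol θ s a) (ω' - ω) ^ 2 +
        2 * ∑ s, ∑ a, M.statDist (pol θ) s * pol θ s a *
        ((inner ℝ (score pol θ s a) ω - M.Adv (pol θ) s a) *
          inner ℝ (score pol θ s a) (ω' - ω)) := by
      simp only [approxError, Finset.mul_sum, ← Finset.sum_add_distrib]
      refine Finset.sum_congr rfl fun s _ => Finset.sum_congr rfl fun a _ => ?_
      rw [inner_sub_right]
      ring
    rw [hexp, hcross, mul_zero, add_zero]
    refine le_add_of_nonneg_right (Finset.sum_nonneg fun s _ => Finset.sum_nonneg fun a _ => ?_)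
    exact mul_nonneg (mul_nonneg ((MDP.isStationary_statDist (hpol θ)).1.1 s) ((hpol θ s).1 a))
      (sq_nonneg _)
  · have h1 := (hF.le_inner θ ω).trans (real_inner_le_norm _ _)
    rw [hω, sq, ← mul_assoc] at h1
    rcases (norm_nonneg ω).eq_or_lt with h0 | h0
    · rw [← h0, mul_zero]; exact norm_nonneg _
    · exact le_of_mul_le_mul_right h1 h0

/-- On a unit vector, which exists as `d ≥ 1`, the Fisher form lies between `μ` and `G²`. The
resulting `1 ≤ G² / μ` lets lone mixing time terms be absorbed into the rate. -/
lemma FisherNondegenerate.le_sq [Nonempty A] {μ : ℝ} (hF : FisherNondegenerate pol M μ)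
    (hd : 1 ≤ d) (h : Regular pol G B) : μ ≤ G ^ 2 := by
  have hq := (MDP.isStationary_statDist (M := M) (h.isPolicy 0)).1
  let e : Param d := EuclideanSpace.single ⟨0, hd⟩ 1
  have he : ‖e‖ = 1 := by simp [e]
  have h1 := hF.le_inner 0 e
  rw [he, one_pow, mul_one, inner_fisherMap] at h1
  refine h1.trans ?_
  have hle : ∀ s a, |inner ℝ (score pol 0 s a) e * inner ℝ (score pol 0 s a) e| ≤ G ^ 2 :=
    fun s a => by
      have : |inner ℝ (score pol 0 s a) e| ≤ G :=
        (abs_real_inner_le_norm _ _).trans (by rw [he, mul_one]; exact h.norm_score_le 0 s a)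
      rw [abs_mul, sq]
      exact mul_le_mul this this (abs_nonneg _) h.G_nonneg
  have := MDP.abs_sum_policy_le hq fun s => MDP.abs_sum_policy_le (h.isPolicy 0 s) (hle s)
  simp only [Finset.mul_sum, ← mul_assoc] at this ⊢
  exact (le_abs_self _).trans this

/-- The transferred approximation error bounds the suboptimality, up to the norm of the natural
policy gradient direction. -/
lemma TransferErrorLE.sub_le [Nonempty A] {πstar : S → A → ℝ} {ε : ℝ}
    (hT : TransferErrorLE pol M πstar ε) (h : Regular pol G B) (hM : M.Ergodic)
    (hstar : IsPolicy πstar) {θ ω : Param d} (hω : IsNPGDirection pol M θ ω) :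
    M.avgReward πstar - M.J pol θ ≤ √ε + G * ‖ω‖ := by
  have hq := (MDP.isStationary_statDist (M := M) hstar).1
  have hdiff : M.avgReward πstar - M.J pol θ = _ :=
    MDP.avgReward_sub hM (h.isPolicy θ) hstar
  let f : S → A → ℝ := fun s a => M.Adv (pol θ) s a - inner ℝ (score pol θ s a) ω
  have hsplit : M.avgReward πstar - M.J pol θ =
      ∑ s, M.statDist πstar s * ∑ a, πstar s a * f s a +
      ∑ s, M.statDist πstar s * ∑ a, πstar s a * inner ℝ (score pol θ s a) ω := by
    rw [hdiff, ← Finset.sum_add_distrib]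
    refine Finset.sum_congr rfl fun s _ => ?_
    rw [← mul_add, ← Finset.sum_add_distrib]
    congr 1
    exact Finset.sum_congr rfl fun a _ => by simp only [f]; ring
  rw [hsplit]
  refine add_le_add ?_ ?_
  -- Jensen's inequality for the square is applied over states and then over actions.
  · refine Real.le_sqrt_of_sq_le ?_
    calc (∑ s, M.statDist πstar s * ∑ a, πstar s a * f s a) ^ 2
        ≤ ∑ s, M.statDist πstar s * (∑ a, πstar s a * f s a) ^ 2 :=
          Real.pow_arith_mean_le_arith_mean_pow_of_even _ _ _ (fun i _ => hq.1 i) hq.2 even_two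
      _ ≤ ∑ s, M.statDist πstar s * ∑ a, πstar s a * f s a ^ 2 :=
          Finset.sum_le_sum fun s _ => mul_le_mul_of_nonneg_left
            (Real.pow_arith_mean_le_arith_mean_pow_of_even _ _ _ (fun i _ => (hstar s).1 i)
              (hstar s).2 even_two) (hq.1 s)
      _ = approxError pol M (M.statDist πstar) πstar ω θ := by
          simp only [approxError, Finset.mul_sum, f]
          exact Finset.sum_congr rfl fun s _ => Finset.sum_congr rfl fun a _ => by ring
      _ ≤ ε := hT θ ω hω
  · refine (le_abs_self _).trans (MDP.abs_sum_policy_le hq fun s =>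
      MDP.abs_sum_policy_le (hstar s) fun a => ?_)
    exact (abs_real_inner_le_norm _ _).trans
      (mul_le_mul_of_nonneg_right (h.norm_score_le θ s a) (norm_nonneg _))

/-- The square root of the transferred approximation error bounds the suboptimality of every
policy of the class: it does so at near-critical points of arbitrarily small performance. -/
lemma TransferErrorLE.sub_le_sqrt [Nonempty A] {πstar : S → A → ℝ} {ε μ : ℝ}
    (hT : TransferErrorLE pol M πstar ε) (h : Regular pol G B) (hM : M.Ergodic)
    (hstar : IsPolicy πstar) (hμ : 0 < μ) (hF : FisherNondegenerate pol M μ) (θ : Param d) :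
    M.avgReward πstar - M.J pol θ ≤ √ε := by
  refine le_of_forall_pos_le_add fun κ hκ => ?_
  have hG := h.G_nonneg
  -- Taking `δ = c²` makes the gradient at most `2c`, so that `(G + 1)‖ω‖ ≤ 2c(G + 1)/μ = κ`. The
  -- summand `1` avoids dividing by zero.
  let c := μ * κ / (2 * (G + 1))
  have hc : 0 < c := by positivity
  obtain ⟨θ', hle, hgrad⟩ := h.exists_near_critical hM θ (pow_pos hc 2)
  obtain ⟨ω, hω, hnorm⟩ := exists_isNPGDirection hμ hF h.isPolicy θ'
  have hsub := hT.sub_le h hM hstar hω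
  rw [Real.sqrt_sq hc.le] at hgrad
  have h1 : (G + 1) * ‖ω‖ ≤ κ := by
    have h2 : μ * ((G + 1) * ‖ω‖) ≤ μ * κ := by
      calc μ * ((G + 1) * ‖ω‖) = (G + 1) * (μ * ‖ω‖) := by ring
        _ ≤ (G + 1) * (2 * c) :=
            mul_le_mul_of_nonneg_left (hnorm.trans hgrad) (by positivity)
        _ = μ * κ := by simp only [c]; field_simp
    exact le_of_mul_le_mul_left h2 hμ
  have h3 := norm_nonneg ω
  linarith

end Gradient

section Trajectories

/-! ### The law of the trajectory -/

variable {S : Type u} {A : Type v} [Fintype S] [Fintype A] [DecidableEq S] [DecidableEq A]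
variable {d : ℕ} {pol : Param d → S → A → ℝ} {G B : ℝ} {M : MDP S A} {I : Input d}

lemma startTimes_congr {N H : ℕ} {τ τ' : ℕ → S × A} (h : ∀ j < H, τ j = τ' j) (s : S)
    (fuel ξ : ℕ) : startTimes N H τ s fuel ξ = startTimes N H τ' s fuel ξ := by
  induction fuel generalizing ξ with
  | zero => rfl
  | succ fuel ih =>
    simp only [startTimes]
    split_ifs with h1 h2 h3 h3
    · rw [ih]
    · exact absurd (h ξ (by omega) ▸ h2) h3
    · exact absurd (h ξ (by omega) ▸ h3) h2
    · rw [ih]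
    · rfl

lemma add_lt_of_mem_startTimes {N H : ℕ} {τ : ℕ → S × A} {s : S} {fuel ξ ζ : ℕ}
    (h : ζ ∈ startTimes N H τ s fuel ξ) : ζ + N < H := by
  induction fuel generalizing ξ with
  | zero => simp [startTimes] at h
  | succ fuel ih =>
    simp only [startTimes] at h
    split_ifs at h with h1 h2
    · rcases List.mem_cons.1 h with rfl | h
      · exact h1
      · exact ih h
    · exact ih h
    · simp at h

lemma rewardSum_congr {N H : ℕ} {τ τ' : ℕ → S × A} (h : ∀ j < H, τ j = τ' j) {ξ : ℕ}
    (hξ : ξ + N < H) : rewardSum M N τ ξ = rewardSum M N τ' ξ :=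
  Finset.sum_congr rfl fun j hj => by
    rw [h _ (by have := Finset.mem_range.1 hj; omega)]

lemma Vhat_congr {N H : ℕ} {τ τ' : ℕ → S × A} (h : ∀ j < H, τ j = τ' j) (s : S) :
    Vhat M N H τ s = Vhat M N H τ' s := by
  unfold Vhat starts
  rw [startTimes_congr h]
  congr 2
  exact List.map_congr_left fun ξ hξ => rewardSum_congr h (add_lt_of_mem_startTimes hξ)

lemma Qhat_congr {N H : ℕ} {π : S → A → ℝ} {τ τ' : ℕ → S × A} (h : ∀ j < H, τ j = τ' j)
    (s : S) (a : A) : Qhat M N H π τ s a = Qhat M N H π τ' s a := by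
  unfold Qhat starts
  rw [startTimes_congr h]
  congr 2
  refine List.map_congr_left fun ξ hξ => ?_
  have hlt := add_lt_of_mem_startTimes hξ
  rw [rewardSum_congr h hlt, h ξ (by omega)]

/-- The gradient estimate depends on the trajectory of the epoch only. -/
lemma gradEst_congr {N H : ℕ} {θ : Param d} {τ τ' : ℕ → S × A} (h : ∀ j < H, τ j = τ' j) :
    gradEst pol M N H θ τ = gradEst pol M N H θ τ' := by
  unfold gradEst
  congr 1
  refine Finset.sum_congr rfl fun t ht => ?_
  rw [h t (Finset.mem_Ico.1 ht).2, Ahat, Ahat, Vhat_congr h, Qhat_congr h]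

lemma iterates_congr {x x' : ℕ → S × A} {k : ℕ} (h : ∀ j < k * I.H, x j = x' j) :
    iterates pol M I x k = iterates pol M I x' k := by
  induction k with
  | zero => rfl
  | succ k ih =>
    have hk : (k + 1) * I.H = k * I.H + I.H := by ring
    have h1 := ih fun j hj => h j (by omega)
    simp only [iterates, h1]
    rw [gradEst_congr (τ' := fun j => x' (k * I.H + j)) fun j hj => h _ (by omega)]

lemma execParam_congr {x x' : ℕ → S × A} {k : ℕ} (h : ∀ j < k * I.H, x j = x' j) :
    execParam pol M I x k = execParam pol M I x' k := by
  rw [execParam, execParam, iterates_congr h]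

/-- The algorithm is non-anticipating: the epoch containing `t` starts no later than `t`, and its
parameter is fixed by the preceding epochs. -/
lemma execParam_div_congr {x x' : ℕ → S × A} {t T : ℕ} (ht : t ≤ T) (h : ∀ j < T, x j = x' j) :
    execParam pol M I x (t / I.H) = execParam pol M I x' (t / I.H) :=
  execParam_congr fun j hj => h j (hj.trans_le ((Nat.div_mul_le_self t I.H).trans ht))

lemma trajProb_congr {x x' : ℕ → S × A} {T : ℕ} (hT : 1 ≤ T) (h : ∀ j < T, x j = x' j) :
    trajProb pol M I T x = trajProb pol M I T x' := by
  unfold trajProb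
  rw [h 0 hT]
  congr 1
  · congr 1
    refine Finset.prod_congr rfl fun t ht => ?_
    have ht := Finset.mem_range.1 ht
    rw [execParam_div_congr ht.le h, h t ht]
  · refine Finset.prod_congr rfl fun t ht => ?_
    have ht := Finset.mem_range.1 ht
    rw [h t (by omega), h (t + 1) (by omega)]

lemma trajProb_succ (x : ℕ → S × A) {T : ℕ} (hT : 1 ≤ T) :
    trajProb pol M I (T + 1) x = trajProb pol M I T x *
      (M.P (x (T - 1)).1 (x (T - 1)).2 (x T).1 *
        pol (execParam pol M I x (T / I.H)) (x T).1 (x T).2) := by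
  obtain ⟨T, rfl⟩ := Nat.exists_eq_add_of_le' hT
  unfold trajProb
  simp only [Nat.add_sub_cancel]
  rw [Finset.prod_range_succ _ (T + 1), Finset.prod_range_succ
    (fun t => M.P (x t).1 (x t).2 (x (t + 1)).1) T]
  ring

lemma trajProb_nonneg (hpol : ∀ θ, IsPolicy (pol θ)) (T : ℕ) (x : ℕ → S × A) :
    0 ≤ trajProb pol M I T x :=
  mul_nonneg (mul_nonneg (M.ρ_mem.1 _) (Finset.prod_nonneg fun _ _ => (hpol _ _).1 _))
    (Finset.prod_nonneg fun _ _ => (M.P_mem _ _).1 _)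

/-! ### Expectations over finite trajectories. -/

variable [Nonempty S] [Nonempty A]

lemma extend_snoc_of_lt {T : ℕ} (x : Fin T → S × A) (y : S × A) {t : ℕ} (ht : t < T) :
    extend (Fin.snoc x y : Fin (T + 1) → S × A) t = extend x t := by
  have : (⟨t, ht.trans T.lt_succ_self⟩ : Fin (T + 1)) = Fin.castSucc ⟨t, ht⟩ := rfl
  rw [extend, extend, dif_pos (ht.trans T.lt_succ_self), dif_pos ht, this, Fin.snoc_castSucc]

lemma extend_snoc_self {T : ℕ} (x : Fin T → S × A) (y : S × A) :
    extend (Fin.snoc x y : Fin (T + 1) → S × A) T = y := by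
  have : (⟨T, T.lt_succ_self⟩ : Fin (T + 1)) = Fin.last T := rfl
  rw [extend, dif_pos T.lt_succ_self, this, Fin.snoc_last]

/-- The expectation of a function of the first `T` state-action pairs. -/
def trajExp (pol : Param d → S → A → ℝ) (M : MDP S A) (I : Input d) (T : ℕ)
    (f : (ℕ → S × A) → ℝ) : ℝ :=
  ∑ x : Fin T → S × A, trajProb pol M I T (extend x) * f (extend x)

/-- Conditioning on the first `T` state-action pairs. -/
lemma trajExp_succ {T : ℕ} (hT : 1 ≤ T) (f g : (ℕ → S × A) → ℝ)
    (hfg : ∀ x : Fin T → S × A,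
      ∑ s, M.P (extend x (T - 1)).1 (extend x (T - 1)).2 s *
        ∑ a, pol (execParam pol M I (extend x) (T / I.H)) s a *
          f (extend (Fin.snoc x (s, a) : Fin (T + 1) → S × A)) = g (extend x)) :
    trajExp pol M I (T + 1) f = trajExp pol M I T g := by
  unfold trajExp
  rw [← (Fin.snocEquiv fun _ : Fin (T + 1) => S × A).sum_comp, Fintype.sum_prod_type,
    Finset.sum_comm]
  refine Finset.sum_congr rfl fun x _ => ?_
  rw [← hfg x, Finset.mul_sum, Fintype.sum_prod_type]
  refine Finset.sum_congr rfl fun s _ => ?_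
  rw [Finset.mul_sum, Finset.mul_sum]
  refine Finset.sum_congr rfl fun a _ => ?_
  have hx : ∀ j < T, extend (Fin.snoc x (s, a) : Fin (T + 1) → S × A) j = extend x j :=
    fun j hj => extend_snoc_of_lt x (s, a) hj
  change trajProb pol M I (T + 1) (extend (Fin.snoc x (s, a) : Fin (T + 1) → S × A)) *
    f (extend (Fin.snoc x (s, a) : Fin (T + 1) → S × A)) = _
  rw [trajProb_succ _ hT, trajProb_congr hT hx, execParam_div_congr le_rfl hx,
    hx (T - 1) (by omega), extend_snoc_self]
  ring

lemma trajExp_one (f : (ℕ → S × A) → ℝ) (g : S → A → ℝ)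
    (hfg : ∀ x : Fin 1 → S × A, f (extend x) = g (extend x 0).1 (extend x 0).2) :
    trajExp pol M I 1 f =
      ∑ s, M.ρ s * ∑ a, pol (lookahead (I.η 1) I.θ₀ I.θ₁) s a * g s a := by
  unfold trajExp
  rw [← (Equiv.funUnique (Fin 1) (S × A)).symm.sum_comp, Fintype.sum_prod_type]
  refine Finset.sum_congr rfl fun s _ => ?_
  rw [Finset.mul_sum]
  refine Finset.sum_congr rfl fun a _ => ?_
  have h0 : extend ((Equiv.funUnique (Fin 1) (S × A)).symm (s, a)) 0 = (s, a) := by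
    simp [extend]
  rw [hfg, h0]
  simp only [trajProb, Finset.prod_range_one, Nat.sub_self, Finset.prod_range_zero, h0,
    Nat.zero_div, execParam, iterates, zero_add]
  ring

lemma trajExp_const_one (hpol : ∀ θ, IsPolicy (pol θ)) {T : ℕ} (hT : 1 ≤ T) :
    trajExp pol M I T (fun _ => 1) = 1 := by
  induction T, hT using Nat.le_induction with
  | base =>
    rw [trajExp_one (g := fun _ _ => 1) _ fun _ => rfl]
    simp [(hpol _ _).2, M.ρ_mem.2]
  | succ T hT ih =>
    rw [trajExp_succ (g := fun _ => 1) hT, ih]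
    intro x
    simp [(hpol _ _).2, (M.P_mem _ _).2]

lemma trajExp_mono (hpol : ∀ θ, IsPolicy (pol θ)) {T : ℕ} {f g : (ℕ → S × A) → ℝ}
    (h : ∀ x, f x ≤ g x) : trajExp pol M I T f ≤ trajExp pol M I T g :=
  Finset.sum_le_sum fun _ _ => mul_le_mul_of_nonneg_left (h _) (trajProb_nonneg hpol T _)

lemma trajExp_add {T : ℕ} (f g : (ℕ → S × A) → ℝ) :
    trajExp pol M I T (fun x => f x + g x) = trajExp pol M I T f + trajExp pol M I T g := by
  simp only [trajExp, mul_add, Finset.sum_add_distrib]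

lemma trajExp_const (hpol : ∀ θ, IsPolicy (pol θ)) {T : ℕ} (hT : 1 ≤ T) (c : ℝ) :
    trajExp pol M I T (fun _ => c) = c := by
  have := trajExp_const_one (M := M) (I := I) hpol hT
  simp only [trajExp, mul_one] at this ⊢
  rw [← Finset.sum_mul, this, one_mul]

/-! ### Regret with respect to the executed policies -/

/-- The regret of the collected rewards with respect to the average rewards of the executed
policies. -/
def execRegret (pol : Param d → S → A → ℝ) (M : MDP S A) (I : Input d) (T : ℕ)
    (x : ℕ → S × A) : ℝ :=
  ∑ t ∈ Finset.range T, (M.J pol (execParam pol M I x (t / I.H)) - M.r (x t).1 (x t).2)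

/-- The expected value of the next state after `T` steps, under the last executed policy. -/
def nextValue (pol : Param d → S → A → ℝ) (M : MDP S A) (I : Input d) (T : ℕ)
    (x : ℕ → S × A) : ℝ :=
  ∑ s, M.P (x (T - 1)).1 (x (T - 1)).2 s *
    M.V (pol (execParam pol M I x ((T - 1) / I.H))) s

/-- Conditional expectation over one action: the policy average of `Q` is `V`. The constant `c`
carries the regret accumulated before. -/
lemma sum_pol_mul_bellman (hM : M.Ergodic) (hpol : ∀ θ, IsPolicy (pol θ)) (θ : Param d) (c : ℝ)
    (s : S) : ∑ a, pol θ s a * (c + (M.J pol θ - M.r s a) -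
      ∑ s', M.P s a s' * M.V (pol θ) s') = c - M.V (pol θ) s := by
  have h := MDP.sum_policy_mul_Q hM (hpol θ) (hpol θ) s
  rw [← MDP.V_bellman hM (hpol θ)] at h
  rw [← h]
  have h1 : ∀ a, pol θ s a * (c + (M.J pol θ - M.r s a) - ∑ s', M.P s a s' * M.V (pol θ) s') =
      pol θ s a * c - pol θ s a * M.Q (pol θ) s a := fun a => by
    rw [MDP.Q_eq hM (hpol θ), MDP.J]; ring
  simp only [h1, Finset.sum_sub_distrib, ← Finset.sum_mul, (hpol θ s).2, one_mul]

/-- The Bellman equations telescope within the epochs, and across the epochs up to the changes of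
the value function. -/
lemma trajExp_execRegret_sub_le (hM : M.Ergodic) (hpol : ∀ θ, IsPolicy (pol θ)) {c : ℝ}
    (hV : ∀ θ s, |M.V (pol θ) s| ≤ c) {D : ℕ → ℝ}
    (hD : ∀ x j s, |M.V (pol (execParam pol M I x (j + 1))) s -
      M.V (pol (execParam pol M I x j)) s| ≤ D j) {T : ℕ} (hT : 1 ≤ T) :
    trajExp pol M I T (fun x => execRegret pol M I T x - nextValue pol M I T x) ≤
      c + ∑ j ∈ Finset.range ((T - 1) / I.H), D j := by
  induction T, hT using Nat.le_induction with
  | base =>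
    rw [trajExp_one (g := fun s a => 0 + (M.J pol (lookahead (I.η 1) I.θ₀ I.θ₁) - M.r s a) -
      ∑ s', M.P s a s' * M.V (pol (lookahead (I.η 1) I.θ₀ I.θ₁)) s')]
    · simp only [sum_pol_mul_bellman hM hpol, Nat.sub_self, Nat.zero_div, Finset.sum_range_zero,
        add_zero]
      refine (le_abs_self _).trans (MDP.abs_sum_policy_le M.ρ_mem fun s => ?_)
      rw [zero_sub, abs_neg]
      exact hV _ s
    · intro x
      simp [execRegret, nextValue, execParam, iterates]
  | succ T hT ih =>
    rw [trajExp_succ (g := fun x => execRegret pol M I T x -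
      ∑ s, M.P (x (T - 1)).1 (x (T - 1)).2 s *
        M.V (pol (execParam pol M I x (T / I.H))) s) hT]
    -- Conditioning produces the value function of the policy used at time `T`, whereas `nextValue`
    -- uses the one at time `T - 1`. They differ only if an epoch starts at `T`, exactly when the
    -- range of the sum of `D` gains a term.
    · have hstep : ∀ x, execRegret pol M I T x - ∑ s, M.P (x (T - 1)).1 (x (T - 1)).2 s *
          M.V (pol (execParam pol M I x (T / I.H))) s ≤
          (execRegret pol M I T x - nextValue pol M I T x) +
          (∑ j ∈ Finset.range (T / I.H), D j - ∑ j ∈ Finset.range ((T - 1) / I.H), D j) := by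
        intro x
        obtain ⟨T, rfl⟩ := Nat.exists_eq_add_of_le' hT
        unfold nextValue
        simp only [Nat.add_sub_cancel]
        rw [Nat.succ_div]
        split_ifs
        · rw [Finset.sum_range_succ, add_sub_cancel_left]
          have h1 := MDP.abs_sum_policy_le (M.P_mem (x T).1 (x T).2) (hD x (T / I.H))
          simp only [mul_sub, Finset.sum_sub_distrib] at h1
          linarith [neg_le_of_abs_le h1]
        · simp
      refine (trajExp_mono hpol hstep).trans ?_
      rw [trajExp_add, trajExp_const hpol hT, Nat.add_sub_cancel]
      linarith
    · intro x
      have hx : ∀ y : S × A, ∀ j < T, extend (Fin.snoc x y : Fin (T + 1) → S × A) j =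
          extend x j := fun y j hj => extend_snoc_of_lt x y hj
      have hf : ∀ s a, execRegret pol M I (T + 1)
            (extend (Fin.snoc x (s, a) : Fin (T + 1) → S × A)) -
          nextValue pol M I (T + 1) (extend (Fin.snoc x (s, a) : Fin (T + 1) → S × A)) =
          execRegret pol M I T (extend x) +
            (M.J pol (execParam pol M I (extend x) (T / I.H)) - M.r s a) -
          ∑ s', M.P s a s' * M.V (pol (execParam pol M I (extend x) (T / I.H))) s' := by
        intro s a
        unfold execRegret nextValue
        rw [Finset.sum_range_succ, Nat.add_sub_cancel, extend_snoc_self,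
          execParam_div_congr le_rfl (hx (s, a))]
        congr 2
        refine Finset.sum_congr rfl fun t ht => ?_
        have ht := Finset.mem_range.1 ht
        rw [execParam_div_congr ht.le (hx (s, a)), hx (s, a) t ht]
      simp only [hf, sum_pol_mul_bellman hM hpol]
      simp only [mul_sub, Finset.sum_sub_distrib,
        ← Finset.sum_mul, (M.P_mem _ _).2, one_mul]

/-- Each step's regret splits into the suboptimality of the executed policy, at most `κ`, and its
execution regret. The term `2 * c` accounts for the values at the two ends of the telescoping sum.
-/
lemma expRegret_le (hM : M.Ergodic) (hpol : ∀ θ, IsPolicy (pol θ)) {c : ℝ}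
    (hV : ∀ θ s, |M.V (pol θ) s| ≤ c) {D : ℕ → ℝ}
    (hD : ∀ x j s, |M.V (pol (execParam pol M I x (j + 1))) s -
      M.V (pol (execParam pol M I x j)) s| ≤ D j) {Jstar κ : ℝ}
    (hκ : ∀ θ, Jstar - M.J pol θ ≤ κ) {T : ℕ} (hT : 1 ≤ T) :
    expRegret pol M I Jstar T ≤ T * κ + 2 * c + ∑ j ∈ Finset.range ((T - 1) / I.H), D j := by
  have h : ∀ x, regret M Jstar T x ≤
      (execRegret pol M I T x - nextValue pol M I T x) + (T * κ + c) := fun x => by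
    have h1 : regret M Jstar T x ≤ T * κ + execRegret pol M I T x := by
      calc regret M Jstar T x ≤ ∑ t ∈ Finset.range T, (κ +
            (M.J pol (execParam pol M I x (t / I.H)) - M.r (x t).1 (x t).2)) :=
            Finset.sum_le_sum fun t _ => by linarith [hκ (execParam pol M I x (t / I.H))]
        _ = _ := by rw [Finset.sum_add_distrib]; simp [execRegret]
    have h2 : nextValue pol M I T x ≤ c :=
      (le_abs_self _).trans (MDP.abs_sum_policy_le (M.P_mem _ _) (hV _))
    linarith
  have h3 : expRegret pol M I Jstar T ≤ trajExp pol M I T fun x =>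
      (execRegret pol M I T x - nextValue pol M I T x) + (T * κ + c) := trajExp_mono hpol h
  rw [trajExp_add, trajExp_const hpol hT] at h3
  linarith [trajExp_execRegret_sub_le hM hpol hV hD hT]

end Trajectories

section Rate

/-! ### The drift of the executed parameters and the regret bound -/

variable {S : Type u} {A : Type v} [Fintype S] [Fintype A] [DecidableEq S] [DecidableEq A]
variable {d : ℕ} {pol : Param d → S → A → ℝ} {G B : ℝ} {M : MDP S A} {I : Input d}

lemma norm_iterates_sub_le {x : ℕ → S × A} {k : ℕ} (hγ : 0 ≤ I.γ (k + 1)) :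
    ‖(iterates pol M I x (k + 1)).2.1 - (iterates pol M I x (k + 1)).1‖ ≤ I.γ (k + 1) := by
  simp only [iterates, add_sub_cancel_left, norm_smul, norm_inv, norm_norm,
    Real.norm_of_nonneg hγ]
  -- Only an inequality, since a vanishing direction gives `‖dir‖⁻¹ * ‖dir‖ = 0`.
  exact mul_le_of_le_one_right hγ (inv_mul_le_one_of_le₀ le_rfl (norm_nonneg _))

/-- The distance between the parameters executed in consecutive epochs. -/
lemma norm_execParam_sub_le (hγ : ∀ k, 0 ≤ I.γ k) (hη : ∀ k, 0 < I.η k)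
    (hη1 : ∀ k, I.η (k + 1) ≤ 1) (x : ℕ → S × A) (j : ℕ) :
    ‖execParam pol M I x (j + 2) - execParam pol M I x (j + 1)‖ ≤
      I.γ (j + 2) / I.η (j + 3) + I.γ (j + 1) / I.η (j + 2) := by
  set p := iterates pol M I x (j + 1) with hp
  set p' := iterates pol M I x (j + 2) with hp'
  have h1 : ‖p.2.1 - p.1‖ ≤ I.γ (j + 1) := norm_iterates_sub_le (hγ _)
  have h2 : ‖p'.2.1 - p'.1‖ ≤ I.γ (j + 2) := norm_iterates_sub_le (hγ _)
  have h3 : p'.1 = p.2.1 := rfl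
  have h4 : execParam pol M I x (j + 2) - execParam pol M I x (j + 1) =
      (I.η (j + 3))⁻¹ • (p'.2.1 - p'.1) -
        ((1 - I.η (j + 2)) / I.η (j + 2)) • (p.2.1 - p.1) := by
    have h5 : (I.η (j + 3))⁻¹ = 1 + (1 - I.η (j + 3)) / I.η (j + 3) := by
      rw [sub_div, div_self (hη _).ne', one_div]; ring
    rw [h5, add_smul, one_smul]
    change p'.2.1 + ((1 - I.η (j + 3)) / I.η (j + 3)) • (p'.2.1 - p'.1) -
      (p.2.1 + ((1 - I.η (j + 2)) / I.η (j + 2)) • (p.2.1 - p.1)) = _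
    rw [h3]
    abel
  rw [h4]
  refine (norm_sub_le _ _).trans (add_le_add ?_ ?_)
  · rw [norm_smul, norm_inv, Real.norm_eq_abs, abs_of_pos (hη _), inv_mul_eq_div]
    exact div_le_div_of_nonneg_right h2 (hη _).le
  · have h6 : 0 ≤ 1 - I.η (j + 2) := sub_nonneg.2 (hη1 (j + 1))
    rw [norm_smul, Real.norm_eq_abs, abs_of_nonneg (div_nonneg h6 (hη _).le), div_mul_eq_mul_div]
    refine div_le_div_of_nonneg_right ?_ (hη _).le
    exact (mul_le_of_le_one_left (norm_nonneg _) (sub_le_self _ (hη _).le)).trans h1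

/-! ### Estimates for the prescribed step sizes and the rate. -/

lemma prescribed_step_le {G μ : ℝ} (hG : 0 ≤ G) (hμ : 0 < μ) (k : ℕ) :
    6 * G / (μ * ((k : ℝ) + 2)) / (2 / (((k + 1 : ℕ) : ℝ) + 2)) ^ ((4 : ℝ) / 5) ≤
      6 * G / μ * ((k : ℝ) + 2) ^ (-(1 / 5) : ℝ) := by
  have hk : (0 : ℝ) ≤ k := Nat.cast_nonneg k
  -- From `2 / (k + 3) ≥ 1 / (k + 2)` both step sizes become powers of `k + 2`, with exponent `-1 +
  -- 4/5 = -1/5`.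
  have h1 : (2 / (((k + 1 : ℕ) : ℝ) + 2)) ^ ((4 : ℝ) / 5) ≥ (((k : ℝ) + 2)⁻¹) ^ ((4 : ℝ) / 5) := by
    refine Real.rpow_le_rpow (by positivity) ?_ (by norm_num)
    rw [inv_eq_one_div, div_le_div_iff₀ (by positivity) (by positivity)]
    push_cast
    linarith
  calc _ ≤ 6 * G / (μ * ((k : ℝ) + 2)) / (((k : ℝ) + 2)⁻¹) ^ ((4 : ℝ) / 5) := by gcongr
    _ = 6 * G / μ * (((k : ℝ) + 2) ^ (-1 : ℝ) * ((k : ℝ) + 2) ^ ((4 : ℝ) / 5)) := by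
      rw [Real.inv_rpow (by positivity), Real.rpow_neg_one]
      field_simp
    _ = _ := by
      rw [← Real.rpow_add (by positivity)]
      norm_num

/-- A discrete integral comparison: Bernoulli's inequality for the concave power `4/5` gives
`(n+1)^(4/5) - n^(4/5) ≥ (4/5)(n+1)^(-1/5)`. -/
lemma sum_rpow_le (n : ℕ) :
    ∑ j ∈ Finset.range n, ((j : ℝ) + 1) ^ (-(1 / 5) : ℝ) ≤ 5 / 4 * (n : ℝ) ^ ((4 : ℝ) / 5) := by
  induction n with
  | zero => simp
  | succ n ih =>
    rw [Finset.sum_range_succ]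
    have hn : (0 : ℝ) < (n : ℝ) + 1 := by positivity
    have h1 : (n : ℝ) ^ ((4 : ℝ) / 5) ≤
        ((n : ℝ) + 1) ^ ((4 : ℝ) / 5) * (1 + 4 / 5 * (-((n : ℝ) + 1)⁻¹)) := by
      have hs : (-1 : ℝ) ≤ -((n : ℝ) + 1)⁻¹ :=
        neg_le_neg (inv_le_one_of_one_le₀ (by linarith [Nat.cast_nonneg (α := ℝ) n]))
      have h2 := rpow_one_add_le_one_add_mul_self hs (p := 4 / 5) (by norm_num) (by norm_num)
      have h3 : (n : ℝ) = ((n : ℝ) + 1) * (1 + -((n : ℝ) + 1)⁻¹) := by field_simp; ring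
      calc (n : ℝ) ^ ((4 : ℝ) / 5)
          = ((n : ℝ) + 1) ^ ((4 : ℝ) / 5) * (1 + -((n : ℝ) + 1)⁻¹) ^ ((4 : ℝ) / 5) := by
            rw [← Real.mul_rpow hn.le (by linarith), ← h3]
        _ ≤ _ := mul_le_mul_of_nonneg_left h2 (by positivity)
    have h4 : ((n : ℝ) + 1) ^ (-(1 / 5) : ℝ) = ((n : ℝ) + 1) ^ ((4 : ℝ) / 5) * ((n : ℝ) + 1)⁻¹ := by
      rw [← Real.rpow_neg_one ((n : ℝ) + 1), ← Real.rpow_add hn]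
      norm_num
    push_cast
    rw [h4]
    nlinarith

/-- There are at most `T^(5/6)` epoch changes, and `5/6 · 4/5 = 2/3`. -/
lemma epochs_rpow_le {T H : ℕ} (hT : 1 ≤ T) (hH : (T : ℝ) ^ ((1 : ℝ) / 6) ≤ H) :
    (((T - 1) / H : ℕ) : ℝ) ^ ((4 : ℝ) / 5) ≤ (T : ℝ) ^ ((2 : ℝ) / 3) := by
  have hT0 : (0 : ℝ) < T := by exact_mod_cast hT
  have hpos : 0 < (T : ℝ) ^ ((1 : ℝ) / 6) := Real.rpow_pos_of_pos hT0 _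
  have h1 : (((T - 1) / H : ℕ) : ℝ) ≤ (T : ℝ) ^ ((5 : ℝ) / 6) := by
    calc (((T - 1) / H : ℕ) : ℝ) ≤ ((T - 1 : ℕ) : ℝ) / H := Nat.cast_div_le
      _ ≤ (T : ℝ) / (T : ℝ) ^ ((1 : ℝ) / 6) := by
        gcongr
        exact Nat.sub_le T 1
      _ = (T : ℝ) ^ ((5 : ℝ) / 6) := by
        conv_lhs => rw [← Real.rpow_one (T : ℝ), ← Real.rpow_mul hT0.le, ← Real.rpow_sub hT0]
        norm_num
  calc _ ≤ ((T : ℝ) ^ ((5 : ℝ) / 6)) ^ ((4 : ℝ) / 5) :=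
        Real.rpow_le_rpow (Nat.cast_nonneg _) h1 (by norm_num)
    _ = _ := by rw [← Real.rpow_mul hT0.le]; norm_num

/-- The last of the four terms suffices. The factor `8` compensates for `log T` being possibly below
one: `log T ≥ 1/2` and `14/5 ≤ 3`. -/
lemma le_regretRate {nA G B Lh tm th μ T : ℝ} (hA : 1 ≤ nA) (hB : 0 ≤ B) (hL : 0 ≤ Lh)
    (hG : 0 ≤ G) (htm : 1 ≤ tm) (hth : 1 ≤ th) (hμ : 0 < μ) (hT : 2 ≤ T) :
    tm ^ 2 * (G ^ 2 * μ⁻¹) * T ^ ((2 : ℝ) / 3) ≤ 8 * regretRate nA G B Lh tm th μ T := by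
  have hlog : 1 / 2 ≤ Real.log T := by
    have := Real.log_le_log two_pos hT
    linarith [Real.log_two_gt_d9]
  have hlog0 : 0 ≤ Real.log T := by linarith
  have hl : 1 / 8 ≤ Real.log T ^ ((14 : ℝ) / 5) := by
    calc (1 : ℝ) / 8 = (1 / 2 : ℝ) ^ (3 : ℝ) := by norm_num
      _ ≤ (1 / 2 : ℝ) ^ ((14 : ℝ) / 5) :=
        Real.rpow_le_rpow_of_exponent_ge (by norm_num) (by norm_num) (by norm_num)
      _ ≤ _ := Real.rpow_le_rpow (by norm_num) hlog (by norm_num)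
  have htm2 : tm ^ 2 ≤ tm ^ ((12 : ℝ) / 5) := by
    rw [← Real.rpow_natCast]
    exact Real.rpow_le_rpow_of_exponent_le htm (by norm_num)
  have hth1 : 1 ≤ th ^ ((7 : ℝ) / 5) := Real.one_le_rpow hth (by norm_num)
  have hA1 : 1 ≤ √nA := Real.one_le_sqrt.2 hA
  have hterm : tm ^ 2 * G ^ 2 ≤
      8 * (√nA * G ^ 2 * tm ^ ((12 : ℝ) / 5) * th ^ ((7 : ℝ) / 5) *
        Real.log T ^ ((14 : ℝ) / 5)) := by
    calc tm ^ 2 * G ^ 2 = 8 * (1 * G ^ 2 * tm ^ 2 * 1 * (1 / 8)) := by ring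
      _ ≤ _ := by gcongr
  unfold regretRate
  have hrest : 0 ≤ G ^ 2 * nA * tm ^ ((7 : ℝ) / 5) * th ^ ((2 : ℝ) / 5) *
        Real.log T ^ ((9 : ℝ) / 5)
      + G ^ 3 * (μ ^ 2)⁻¹ * tm ^ ((2 : ℝ) / 5) * th ^ ((2 : ℝ) / 5) * Lh *
          Real.log T ^ ((4 : ℝ) / 5)
      + √nA * B * G * tm ^ ((7 : ℝ) / 5) * th ^ ((2 : ℝ) / 5) * Real.log T ^ ((9 : ℝ) / 5) := by
    positivity
  calc tm ^ 2 * (G ^ 2 * μ⁻¹) * T ^ ((2 : ℝ) / 3) = tm ^ 2 * G ^ 2 * (μ⁻¹ * T ^ ((2 : ℝ) / 3)) := by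
        ring
    _ ≤ 8 * _ * (μ⁻¹ * T ^ ((2 : ℝ) / 3)) :=
        mul_le_mul_of_nonneg_right
          (hterm.trans (mul_le_mul_of_nonneg_left (le_add_of_nonneg_left hrest) (by norm_num)))
          (by positivity)
    _ = _ := by ring

variable [Nonempty S] [Nonempty A]

/-- The drift of the value functions along the run of the algorithm. -/
lemma abs_V_execParam_sub_le (hM : M.Ergodic) (h : Regular pol G B) {μ : ℝ} (hμ : 0 < μ)
    (T : ℕ) (θ₀ θ₁ : Param d) (x : ℕ → S × A) (j : ℕ) (s : S) :
    |M.V (pol (execParam pol M (prescribedInput pol M G μ T θ₀ θ₁) x (j + 1))) s -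
      M.V (pol (execParam pol M (prescribedInput pol M G μ T θ₀ θ₁) x j)) s| ≤
      (if j = 0 then 6 * (M.mixTime pol : ℝ) else 0) +
        252 * ((M.mixTime pol : ℝ) ^ 2 * (G ^ 2 * μ⁻¹)) * ((j : ℝ) + 1) ^ (-(1 / 5) : ℝ) := by
  have hG := h.G_nonneg
  have hV := fun θ => MDP.abs_V_le_mixTime hM h.isPolicy θ s
  rcases j with - | j
  -- The initial parameters are arbitrary, so the first change is only bounded by twice the bound `3
  -- t_mix` on value functions.
  · rw [if_pos rfl]
    refine le_add_of_le_of_nonneg ((abs_sub _ _).trans ?_) (by positivity)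
    linarith [hV (execParam pol M (prescribedInput pol M G μ T θ₀ θ₁) x (0 + 1)),
      hV (execParam pol M (prescribedInput pol M G μ T θ₀ θ₁) x 0)]
  · rw [if_neg j.succ_ne_zero, zero_add]
    set I := prescribedInput pol M G μ T θ₀ θ₁ with hI
    have hη : ∀ k, 0 < I.η k := fun k => Real.rpow_pos_of_pos (by positivity) _
    have hη1 : ∀ k, I.η (k + 1) ≤ 1 := fun k => by
      refine Real.rpow_le_one (by positivity) ?_ (by norm_num)
      rw [div_le_one (by positivity)]
      linarith [Nat.cast_nonneg (α := ℝ) (k + 1)]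
    have hγ : ∀ k, 0 ≤ I.γ k := fun k => by simp only [hI, prescribedInput]; positivity
    have hstep : ∀ k ≥ j + 1,
        I.γ k / I.η (k + 1) ≤ 6 * G / μ * (((j + 1 : ℕ) : ℝ) + 1) ^ (-(1 / 5) : ℝ) :=
      fun k hk => (prescribed_step_le hG hμ k).trans (by
        refine mul_le_mul_of_nonneg_left (Real.rpow_le_rpow_of_nonpos (by positivity) ?_
          (by norm_num)) (by positivity)
        have : ((j + 1 : ℕ) : ℝ) ≤ k := by exact_mod_cast hk
        linarith)
    have hnorm := norm_execParam_sub_le (pol := pol) (M := M) hγ hη hη1 x j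
    have h1 := hstep (j + 2) (by omega)
    have h2 := hstep (j + 1) le_rfl
    refine (MDP.abs_V_sub_le hM (h.isPolicy _) (h.isPolicy _) (MDP.one_le_mixTime hM h.isPolicy)
      (MDP.mixTimeOf_le_mixTime hM h.isPolicy _) (MDP.mixTimeOf_le_mixTime hM h.isPolicy _)
      (h.sum_abs_sub_le _ _) s).trans ?_
    -- The constant is `252 = 21 · 2 · 6`: Lipschitz constant of `V`, two displacement terms, and
    -- the factor in `γ`.
    calc 21 * (M.mixTime pol : ℝ) ^ 2 *
          (G * ‖execParam pol M I x (j + 1 + 1) - execParam pol M I x (j + 1)‖)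
        ≤ 21 * (M.mixTime pol : ℝ) ^ 2 *
          (G * (2 * (6 * G / μ * (((j + 1 : ℕ) : ℝ) + 1) ^ (-(1 / 5) : ℝ)))) := by
          gcongr
          linarith
      _ = _ := by rw [div_eq_mul_inv]; ring

lemma expRegret_prescribedInput_le (hM : M.Ergodic) (hd : 1 ≤ d) (h : Regular pol G B)
    {πstar : S → A → ℝ} (hstar : M.IsOptimal πstar) {ε μ : ℝ}
    (hT : TransferErrorLE pol M πstar ε) (hμ : 0 < μ) (hF : FisherNondegenerate pol M μ)
    (Lh : NNReal) (θ₀ θ₁ : Param d) {T : ℕ} (hT2 : 2 ≤ T) :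
    expRegret pol M (prescribedInput pol M G μ T θ₀ θ₁) (M.avgReward πstar) T ≤
      T * √ε + 2616 * regretRate (Fintype.card A) G B Lh (M.mixTime pol) (M.hitTime pol) μ T := by
  have hG := h.G_nonneg
  have hB : 0 ≤ B :=
    (norm_nonneg _).trans (h.norm_hessian_le 0 (Classical.arbitrary S) (Classical.arbitrary A))
  have htm : (1 : ℝ) ≤ M.mixTime pol := by exact_mod_cast MDP.one_le_mixTime hM h.isPolicy
  have hth := MDP.one_le_hitTime hM h.isPolicy
  have hT2' : (2 : ℝ) ≤ T := by exact_mod_cast hT2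
  have hT1 : 1 ≤ T := by omega
  have hA : (1 : ℝ) ≤ Fintype.card A := by exact_mod_cast Fintype.card_pos (α := A)
  have hratio : 1 ≤ G ^ 2 * μ⁻¹ := by
    rw [← div_eq_mul_inv, one_le_div hμ]
    exact hF.le_sq hd h
  have hTpow : 1 ≤ (T : ℝ) ^ ((2 : ℝ) / 3) := Real.one_le_rpow (by linarith) (by norm_num)
  have hH : (T : ℝ) ^ ((1 : ℝ) / 6) ≤ (prescribedInput pol M G μ T θ₀ θ₁).H := by
    have hlogb : 1 ≤ Real.logb 2 T := by
      rw [Real.le_logb_iff_rpow_le one_lt_two (by linarith)]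
      simpa using hT2'
    refine le_trans ?_ (Nat.le_ceil _)
    refine le_mul_of_one_le_left (by positivity) ?_
    have := one_le_mul_of_one_le_of_one_le htm hth
    have := one_le_mul_of_one_le_of_one_le this (one_le_pow₀ hlogb (n := 2))
    nlinarith
  have hreg := expRegret_le hM h.isPolicy (MDP.abs_V_le_mixTime hM h.isPolicy)
    (abs_V_execParam_sub_le hM h hμ T θ₀ θ₁)
    (fun θ => hT.sub_le_sqrt h hM hstar.1 hμ hF θ) hT1
  refine hreg.trans ?_
  set n := (T - 1) / (prescribedInput pol M G μ T θ₀ θ₁).H with hn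
  set E := (M.mixTime pol : ℝ) ^ 2 * (G ^ 2 * μ⁻¹) with hE
  have hE0 : 0 ≤ E := by positivity
  have hn45 : (n : ℝ) ^ ((4 : ℝ) / 5) ≤ (T : ℝ) ^ ((2 : ℝ) / 3) := epochs_rpow_le hT1 hH
  have hsum : ∑ j ∈ Finset.range n, ((if j = 0 then 6 * (M.mixTime pol : ℝ) else 0) +
      252 * E * ((j : ℝ) + 1) ^ (-(1 / 5) : ℝ)) ≤
      6 * M.mixTime pol + 252 * E * (5 / 4 * (T : ℝ) ^ ((2 : ℝ) / 3)) := by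
    rw [Finset.sum_add_distrib, ← Finset.mul_sum]
    refine add_le_add ?_ (mul_le_mul_of_nonneg_left ((sum_rpow_le n).trans (by gcongr))
      (by positivity))
    rw [Finset.sum_ite_eq' (Finset.range n) 0]
    split_ifs
    · exact le_rfl
    · positivity
  have hmE : (M.mixTime pol : ℝ) ≤ E * (T : ℝ) ^ ((2 : ℝ) / 3) := by
    calc (M.mixTime pol : ℝ) ≤ (M.mixTime pol : ℝ) ^ 2 := le_self_pow₀ htm two_ne_zero
      _ ≤ E := le_mul_of_one_le_right (by positivity) hratio
      _ ≤ _ := le_mul_of_one_le_right hE0 hTpow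
  have hrate := le_regretRate hA hB Lh.coe_nonneg hG htm hth hμ hT2'
  rw [← hE] at hrate
  -- The mixing time enters `12` times, `6` from the telescoping ends and `6` from the first epoch
  -- change. With `252 · 5/4 = 315` the total is `327 E T^(2/3)`, and `327 · 8 = 2616`.
  linarith

end Rate

end AvgMDP

end

theorem theorem1 :
    ∃ C : ℝ, 0 < C ∧
      ∀ (S : Type*) (A : Type*) [Fintype S] [Fintype A] [Nonempty S] [Nonempty A]
        [DecidableEq S] [DecidableEq A] (M : AvgMDP.MDP S A) (_ : M.Ergodic)
        (d : ℕ) (_ : 1 ≤ d) (pol : AvgMDP.Param d → S → A → ℝ)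
        (G B μ ε : ℝ) (Lh : NNReal)
        (_ : AvgMDP.Regular pol G B)
        (πstar : S → A → ℝ) (_ : M.IsOptimal πstar)
        (_ : AvgMDP.TransferErrorLE pol M πstar ε)
        (_ : 0 < μ) (_ : AvgMDP.FisherNondegenerate pol M μ)
        (_ : AvgMDP.GradientSmooth (M.J pol) Lh)
        (θ₀ θ₁ : AvgMDP.Param d) (T : ℕ) (_ : 2 ≤ T),
        AvgMDP.expRegret pol M (AvgMDP.prescribedInput pol M G μ T θ₀ θ₁)
            (M.avgReward πstar) T ≤
          T * √ε + C * AvgMDP.regretRate (Fintype.card A) G B Lh (M.mixTime pol)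
            (M.hitTime pol) μ T := by
  refine ⟨2616, by norm_num, ?_⟩
  intro S A _ _ _ _ _ _ M hM d hd pol G B μ ε Lh hreg πstar hstar hT hμ hF _ θ₀ θ₁ T hT2
  exact AvgMDP.expRegret_prescribedInput_le hM hd hreg hstar hT hμ hF Lh θ₀ θ₁ hT2
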